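/- Let $k$ be an algebraically closed field of characteristic zero and let $Z \subset \mathbb{P}^n_k$ be an irreducible projective variety (an integral closed subscheme, given by a homogeneous prime ideal of $k[x_0,\dots,x_n]$ that does not contain the irrelevant ideal). For a closed subscheme $Y \subset \mathbb{P}^n_k$ and a closed point $p \in Y$, let $e_p(Y)$ denote the Samuel multiplicity of the local ring $\mathcal{O}_{Y,p}$ with respect to its maximal ideal $\mathfrak{m}$, that is, with $d=\dim \mathcal{O}_{Y,p}$, $$e_p(Y) = \lim_{t\to\infty} \frac{d!\;\operatorname{length}(\mathcal{O}_{Y,p}/\mathfrak{m}^t)}{t^d}.$$ Then there is a nonempty Zariski open subset $U$ of the dual projective space $(\mathbb{P}^n_k)^*$ such that, for every hyperplane $L \in U$, the scheme-theoretic hyperplane section $H = Z \cap L$ satisfies $$e_p(H) = e_p(Z) \quad \text{for every closed point } p \in H.$$ -/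

import Mathlib

open Filter Topology

namespace ProjVar

universe u

noncomputable section

/- ### Samuel multiplicity -/

/-- `HasSamuelMultiplicity A q e`: the Samuel multiplicity of the ring `A` with respect to the
ideal `q` is `e`, that is, with `d = dim A` (Krull dimension), the length of `A ⧸ q ^ t` is
`(e / d!) t ^ d + o(t ^ d)` for `t → ∞`. It is meant for a Noetherian local ring `A` and an ideal
`q` primary to the maximal ideal, where all these lengths and `d` are finite. -/
def HasSamuelMultiplicity (A : Type u) [CommRing A] (q : Ideal A) (e : ℕ) : Prop :=
  ∃ d : ℕ, ringKrullDim A = (d : WithBot ℕ∞) ∧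
    (∀ t : ℕ, Module.length A (A ⧸ q ^ t) ≠ ⊤) ∧
    Tendsto (fun t : ℕ =>
        (d.factorial : ℝ) * ((Module.length A (A ⧸ q ^ t)).toNat : ℝ) / (t : ℝ) ^ d)
      atTop (𝓝 (e : ℝ))

/-- The Samuel multiplicity is a well defined number. -/
theorem HasSamuelMultiplicity.unique {A : Type u} [CommRing A] {q : Ideal A} {e e' : ℕ}
    (h : HasSamuelMultiplicity A q e) (h' : HasSamuelMultiplicity A q e') : e = e' := by
  obtain ⟨d, hd, -, h⟩ := h
  obtain ⟨d', hd', -, h'⟩ := h'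
  have hdd : d = d' := by
    rw [hd] at hd'
    exact_mod_cast hd'
  subst hdd
  exact_mod_cast tendsto_nhds_unique h h'

/- ### Closed subschemes of projective space and their local rings -/

variable (k : Type u) [Field k] (n : ℕ)

/-- The closed points of `ℙⁿ` over `k`: the lines through the origin in `k ^ (n + 1)`. -/
abbrev PPoint : Type u := Projectivization k (Fin (n + 1) → k)

/-- The homogeneous coordinate ring `k[x₀, …, xₙ]` of `ℙⁿ`. -/
abbrev CoordRing : Type u := MvPolynomial (Fin (n + 1)) k

/-- The standard grading of `k[x₀, …, xₙ]`. -/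
abbrev grading : ℕ → Submodule k (CoordRing k n) :=
  MvPolynomial.homogeneousSubmodule (Fin (n + 1)) k

instance grading_gradedAlgebra : GradedAlgebra (grading k n) :=
  MvPolynomial.gradedAlgebra

variable {k n}

/-- The homogeneous prime ideal of a point `p = [v₀ : … : vₙ]` of `ℙⁿ`: the polynomials that vanish
identically on the line `t ↦ (t v₀, …, t vₙ)`, i.e. the kernel of `k[x₀, …, xₙ] → k[t]`,
`xᵢ ↦ vᵢ t`. -/
def pointIdeal (p : PPoint k n) : Ideal (CoordRing k n) :=
  RingHom.ker (MvPolynomial.aeval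
    (fun i => Polynomial.C (p.rep i) * Polynomial.X) : CoordRing k n →ₐ[k] Polynomial k)

instance pointIdeal_isPrime (p : PPoint k n) : (pointIdeal p).IsPrime :=
  RingHom.ker_isPrime _

/-- The local ring `𝒪_{ℙⁿ, p}`: fractions `f / g` of homogeneous polynomials of the same degree
with `g(p) ≠ 0`. -/
abbrev PLocalRing (p : PPoint k n) : Type u :=
  HomogeneousLocalization.AtPrime (grading k n) (pointIdeal p)

/-- The point `p` lies on the closed subscheme `V₊(I)` of `ℙⁿ` defined by the homogeneous
ideal `I`. -/
def MemV (I : Ideal (CoordRing k n)) (p : PPoint k n) : Prop :=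
  I ≤ pointIdeal p

/-- The stalk at `p` of the ideal sheaf of `V₊(I)`: the fractions `f / g` in `𝒪_{ℙⁿ, p}` with
numerator in `I`, that is, the contraction to `𝒪_{ℙⁿ, p} = S_(p)` of the extension of `I` to the
ordinary localization `S_p` of `S = k[x₀, …, xₙ]`. -/
def stalkIdeal (I : Ideal (CoordRing k n)) (p : PPoint k n) : Ideal (PLocalRing p) :=
  (I.map (algebraMap (CoordRing k n) (Localization.AtPrime (pointIdeal p)))).comap
    (algebraMap (PLocalRing p) (Localization.AtPrime (pointIdeal p)))

/-- The local ring of the closed subscheme `V₊(I)` at a point `p`. -/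
abbrev LocalRingV (I : Ideal (CoordRing k n)) (p : PPoint k n) : Type u :=
  PLocalRing p ⧸ stalkIdeal I p

/-- The maximal ideal of the local ring of `V₊(I)` at a point `p` of `V₊(I)`. -/
def maxIdealV (I : Ideal (CoordRing k n)) (p : PPoint k n) : Ideal (LocalRingV I p) :=
  (IsLocalRing.maximalIdeal (PLocalRing p)).map (Ideal.Quotient.mk (stalkIdeal I p))

/-- `HasMultiplicityAt I p e`: the multiplicity `e_p(V₊(I))` of the closed subscheme `V₊(I)` of
`ℙⁿ` at its point `p` is `e`; it is the Samuel multiplicity of the local ring of `V₊(I)` at `p` with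
respect to its maximal ideal. -/
def HasMultiplicityAt (I : Ideal (CoordRing k n)) (p : PPoint k n) (e : ℕ) : Prop :=
  HasSamuelMultiplicity (LocalRingV I p) (maxIdealV I p) e

/- ### Hyperplanes -/

/-- The linear form `a₀ x₀ + … + aₙ xₙ` of the hyperplane `a = [a₀ : … : aₙ]`, a point of the dual
projective space (well defined up to a nonzero scalar). -/
def linearForm (a : PPoint k n) : CoordRing k n :=
  ∑ i, MvPolynomial.C (a.rep i) * MvPolynomial.X i

/-- The homogeneous ideal `I + (ℓ_a)` of the scheme-theoretic hyperplane section
`V₊(I) ∩ {ℓ_a = 0}`. -/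
def hyperplaneSection (I : Ideal (CoordRing k n)) (a : PPoint k n) : Ideal (CoordRing k n) :=
  I ⊔ Ideal.span {linearForm a}

/-- Zariski open subsets of `ℙⁿ` (on closed points): complements of common zero loci of sets of
homogeneous polynomials. -/
def IsZariskiOpen (U : Set (PPoint k n)) : Prop :=
  ∃ T : Set (CoordRing k n), (∀ f ∈ T, ∃ m : ℕ, f.IsHomogeneous m) ∧
    ∀ p : PPoint k n, p ∈ U ↔ ¬ ∀ f ∈ T, MvPolynomial.eval p.rep f = 0

end

end ProjVar

/-! ### Eventually polynomial functions -/

/-! Let `A` be the local ring of `Z` at `p`, of dimension `d` and with maximal ideal `m`, and let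
`l` be the local equation of `L`. The multiplicities of `A` and `A ⧸ l` agree as soon as `l` and `d
- 1` further elements generate a reduction of `m` (`exists_hasSamuelMultiplicity_quotient`). Indeed
the length of `A ⧸ (l, m ^ t)` is that of `A ⧸ m ^ t` minus that of `A ⧸ (m ^ t : l)`. The colon
ideal contains `m ^ (t - 1)`, and by Artin–Rees the excess is bounded by a fixed number of values of
the Hilbert function of the annihilator of the initial form of `l` in the associated graded ring.
The other `d - 1` elements control that annihilator, so the excess does not affect the leading term.

What remains is that a general hyperplane has this property at all its points on `Z` at once. This
is a dimension count in an affine chart, for `V(P)` of dimension `d` in affine `n`-space. Let `V(Q)`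
be an irreducible closed subset of `V(P)` with generic point `ξ`. An elimination argument as in
Noether normalization, over the infinite field `k`, gives `d` linear forms `T_j` over `k` that
generate a reduction of the ideal of `ξ` modulo its higher powers (`exists_isLinearReduction`);
Nakayama later removes this error in the local rings. The finitely many relations that witness the
reduction hold with a common denominator `s`, so they specialize to the points `c` of a nonempty
open part of `V(Q)`.

Complete the `T_j` to a basis by `e = n - d` further forms. A hyperplane through `c` with
coordinates `(b, β)` in this basis may replace `T_j` unless a determinant vanishes, and this
determinant is a polynomial in `b_j` whose leading coefficient is a power of `s`
(`isReductionMember_of_det_ne_zero`). If all `d` determinants vanish, every `b_j` is algebraic over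
`c` and `β`. So the bad pairs (point, hyperplane) depend on at most `dim V(Q) + e ≤ n` parameters,
whereas hyperplane equations have `n + 1` coefficients. Hence the bad equations satisfy a nonzero
polynomial `Φ` (`exists_mul_aeval_mem_span_replaceDet`, `exists_generic_stratum`). Noetherian
induction on `Q` and the finitely many charts leave a finite product of such `Φ`. -/

/-- The `e`-th difference of `f` vanishes for large arguments, i.e. `f` is eventually a polynomial
of degree less than `e`. -/
def EventuallyPoly (e : ℕ) (f : ℕ → ℤ) : Prop :=
  ∀ᶠ i in atTop, (fwdDiff 1)^[e] f i = 0

theorem fwdDiff_iter_sub (f g : ℕ → ℤ) (e : ℕ) :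
    (fwdDiff 1)^[e] (fun i => f i - g i) = fun i => (fwdDiff 1)^[e] f i - (fwdDiff 1)^[e] g i := by
  induction e generalizing f g with
  | zero => rfl
  | succ e ih =>
    simp only [Function.iterate_succ_apply]
    rw [← ih]
    congr 1
    ext i
    simp only [fwdDiff]
    ring

theorem fwdDiff_iter_mul_left (c : ℤ) (f : ℕ → ℤ) (e : ℕ) :
    (fwdDiff 1)^[e] (fun i => c * f i) = fun i => c * (fwdDiff 1)^[e] f i := by
  induction e generalizing f with
  | zero => rfl
  | succ e ih =>
    simp only [Function.iterate_succ_apply]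
    rw [← ih]
    congr 1
    ext i
    simp only [fwdDiff]
    ring

theorem fwdDiff_iter_shift (f : ℕ → ℤ) (e i : ℕ) :
    (fwdDiff 1)^[e] (fun i => f (i + 1)) i = (fwdDiff 1)^[e] f (i + 1) := by
  induction e generalizing f i with
  | zero => rfl
  | succ e ih => simp only [Function.iterate_succ_apply', fwdDiff, ih]

namespace EventuallyPoly

theorem sub {e : ℕ} {f g : ℕ → ℤ} (hf : EventuallyPoly e f) (hg : EventuallyPoly e g) :
    EventuallyPoly e (fun i => f i - g i) := by
  filter_upwards [hf, hg] with i h1 h2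
  rw [fwdDiff_iter_sub]
  simp only [h1, h2, sub_zero]

theorem shift {e : ℕ} {f : ℕ → ℤ} (hf : EventuallyPoly e f) :
    EventuallyPoly e (fun i => f (i + 1)) := by
  filter_upwards [(tendsto_add_atTop_nat 1).eventually hf] with i h1
  rw [fwdDiff_iter_shift, h1]

theorem succ_iff {e : ℕ} {f : ℕ → ℤ} :
    EventuallyPoly (e + 1) f ↔ EventuallyPoly e (fun i => f (i + 1) - f i) := Iff.rfl

theorem exists_eventually_eq {e : ℕ} {f : ℕ → ℤ} (hf : EventuallyPoly (e + 1) f) :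
    ∃ c : ℤ, ∀ᶠ i in atTop, (fwdDiff 1)^[e] f i = c := by
  obtain ⟨N, hN⟩ := eventually_atTop.1 hf
  refine ⟨(fwdDiff 1)^[e] f N, eventually_atTop.2 ⟨N, fun i hi => ?_⟩⟩
  induction i, hi using Nat.le_induction with
  | base => rfl
  | succ i hi ih =>
    have := hN i hi
    rw [Function.iterate_succ_apply', fwdDiff] at this
    omega

end EventuallyPoly

theorem tendsto_factorial_mul_choose_div_pow (e : ℕ) :
    Tendsto (fun t : ℕ => (e.factorial : ℝ) * (t.choose e : ℝ) / (t : ℝ) ^ e) atTop (𝓝 1) := by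
  have h := isEquivalent_choose e
  have h2 := (Asymptotics.isEquivalent_iff_tendsto_one ?_).1 h
  · refine h2.congr fun t => ?_
    simp only [Pi.div_apply]
    rw [div_div_eq_mul_div, mul_comm]
  · filter_upwards [eventually_gt_atTop 0] with t ht
    positivity

/-- Subtracting `c` times the binomial coefficient `t.choose e` kills the `e`-th difference. The
hypothesis `H` is the induction hypothesis of `EventuallyPoly.tendsto_div_pow`, which makes `H`
available unconditionally afterwards. -/
theorem tendsto_of_fwdDiff_iter_eq_aux {e : ℕ}
    (H : ∀ g : ℕ → ℤ, EventuallyPoly e g →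
      Tendsto (fun t : ℕ => (g t : ℝ) / (t : ℝ) ^ e) atTop (𝓝 0))
    {f : ℕ → ℤ} {c : ℤ} (hc : ∀ᶠ i in atTop, (fwdDiff 1)^[e] f i = c) :
    Tendsto (fun t : ℕ => (e.factorial : ℝ) * (f t : ℝ) / (t : ℝ) ^ e) atTop (𝓝 (c : ℝ)) := by
  have h1 : EventuallyPoly e (fun i => f i - c * (i.choose e : ℤ)) := by
    filter_upwards [hc] with i hi
    rw [fwdDiff_iter_sub, fwdDiff_iter_mul_left]
    have := fwdDiff_iter_choose 0 e
    simp only [add_zero] at this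
    simp only [hi, this]
    simp
  have h2 := (H _ h1).const_mul (e.factorial : ℝ)
  have h3 := (tendsto_factorial_mul_choose_div_pow e).const_mul (c : ℝ)
  have h4 := h2.add h3
  rw [mul_zero, zero_add, mul_one] at h4
  refine h4.congr fun t => ?_
  push_cast
  ring

theorem EventuallyPoly.tendsto_div_pow {e : ℕ} {f : ℕ → ℤ} (hf : EventuallyPoly e f) :
    Tendsto (fun t : ℕ => (f t : ℝ) / (t : ℝ) ^ e) atTop (𝓝 0) := by
  induction e generalizing f with
  | zero =>
    refine tendsto_const_nhds.congr' ?_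
    filter_upwards [hf] with t ht
    simp only [Function.iterate_zero, id] at ht
    simp [ht]
  | succ e ih =>
    obtain ⟨c, hc⟩ := hf.exists_eventually_eq
    have h1 := tendsto_of_fwdDiff_iter_eq_aux (fun g hg => ih hg) hc
    have h2 : Tendsto (fun t : ℕ => ((e.factorial : ℝ) * (f t : ℝ) / (t : ℝ) ^ e) *
        ((e.factorial : ℝ)⁻¹ * (t : ℝ)⁻¹)) atTop (𝓝 (c * ((e.factorial : ℝ)⁻¹ * 0))) :=
      h1.mul (tendsto_const_nhds.mul (tendsto_inv_atTop_zero.comp tendsto_natCast_atTop_atTop))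
    rw [mul_zero, mul_zero] at h2
    refine h2.congr fun t => ?_
    have : (e.factorial : ℝ) ≠ 0 := by positivity
    rw [pow_succ]
    field_simp

theorem tendsto_of_fwdDiff_iter_eq {e : ℕ} {f : ℕ → ℤ} {c : ℤ}
    (hc : ∀ᶠ i in atTop, (fwdDiff 1)^[e] f i = c) :
    Tendsto (fun t : ℕ => (e.factorial : ℝ) * (f t : ℝ) / (t : ℝ) ^ e) atTop (𝓝 (c : ℝ)) :=
  tendsto_of_fwdDiff_iter_eq_aux (fun _ hg => hg.tendsto_div_pow) hc

theorem tendsto_div_pow_sub {g : ℕ → ℝ} {d : ℕ} {L : ℝ} (j : ℕ)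
    (h : Tendsto (fun t : ℕ => g t / (t : ℝ) ^ d) atTop (𝓝 L)) :
    Tendsto (fun t : ℕ => g (t - j) / (t : ℝ) ^ d) atTop (𝓝 L) := by
  rw [← tendsto_add_atTop_iff_nat j]
  have h1 : Tendsto (fun t : ℕ => (t : ℝ) / ((t + j : ℕ) : ℝ)) atTop (𝓝 1) := by
    have := tendsto_natCast_div_add_atTop (𝕜 := ℝ) (j : ℝ)
    simpa using this
  have h2 := h.mul (h1.pow d)
  rw [one_pow, mul_one] at h2
  refine h2.congr' ?_
  filter_upwards [eventually_gt_atTop 0] with t ht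
  have : (t : ℝ) ≠ 0 := by positivity
  simp only [Nat.add_sub_cancel]
  rw [div_pow]
  field_simp

/-! ### Colengths of ideals -/

/-- The length of `A ⧸ I` as an integer (meaningful if it is finite). -/
noncomputable def colength {A : Type*} [CommRing A] (I : Ideal A) : ℤ :=
  ((Module.length A (A ⧸ I)).toNat : ℤ)

section Colength

variable {A : Type*} [CommRing A]

theorem length_quotient_ne_top_of_le {I J : Ideal A} (hIJ : I ≤ J)
    (hI : Module.length A (A ⧸ I) ≠ ⊤) : Module.length A (A ⧸ J) ≠ ⊤ :=
  ne_top_of_le_ne_top hI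
    (Module.length_le_of_surjective (Submodule.factor hIJ) (Submodule.factor_surjective hIJ))

theorem length_quotient_eq_add {M : Type*} [AddCommGroup M] [Module A M] (I J : Submodule A M)
    (hIJ : I ≤ J) :
    Module.length A (M ⧸ I) =
      Module.length A (J.map I.mkQ) + Module.length A (M ⧸ J) := by
  rw [Module.length_eq_add_of_exact (J.map I.mkQ).subtype (J.map I.mkQ).mkQ
    (Submodule.subtype_injective _) (Submodule.mkQ_surjective _)
    (LinearMap.exact_subtype_mkQ _)]
  rw [(Submodule.quotientQuotientEquivQuotient I J hIJ).length_eq]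

/-- Multiplication by `T` identifies `N ⧸ {x ∈ N | T x ∈ N'}` with `(N' + T N) ⧸ N'`. -/
theorem colength_sub_eq_of_mul {N N' K C : Ideal A} (T : A) (hK : ∀ x, x ∈ K ↔ x ∈ N ∧ T * x ∈ N')
    (hC : C = N' ⊔ Ideal.span {T} * N)
    (hKf : Module.length A (A ⧸ K) ≠ ⊤) (hNf' : Module.length A (A ⧸ N') ≠ ⊤) :
    colength K - colength N = colength N' - colength C := by
  have hKN : K ≤ N := fun x hx => ((hK x).1 hx).1
  have hNC : N' ≤ C := hC ▸ le_sup_left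
  have e1 := length_quotient_eq_add K N hKN
  have e2 := length_quotient_eq_add N' C hNC
  let f : N →ₗ[A] A ⧸ K := K.mkQ ∘ₗ N.subtype
  let g : N →ₗ[A] A ⧸ N' := N'.mkQ ∘ₗ (LinearMap.lsmul A A T) ∘ₗ N.subtype
  have hf : LinearMap.range f = Submodule.map K.mkQ N := by
    rw [LinearMap.range_comp, Submodule.range_subtype]
  have hg : LinearMap.range g = Submodule.map N'.mkQ C := by
    rw [LinearMap.range_comp, LinearMap.range_comp, Submodule.range_subtype, hC,
      Submodule.map_sup, Submodule.mkQ_map_self, bot_sup_eq]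
    congr 1
    ext x
    simp only [Submodule.mem_map, LinearMap.lsmul_apply, smul_eq_mul,
      Ideal.mem_span_singleton_mul]
  have hker : LinearMap.ker f = LinearMap.ker g := by
    ext ⟨x, hx⟩
    simp only [f, g, LinearMap.mem_ker, LinearMap.comp_apply, Submodule.subtype_apply,
      Submodule.mkQ_apply, Submodule.Quotient.mk_eq_zero, LinearMap.lsmul_apply, smul_eq_mul]
    rw [hK]
    exact and_iff_right hx
  have e3 : Module.length A (Submodule.map K.mkQ N) = Module.length A (Submodule.map N'.mkQ C) := by
    rw [← hf, ← hg]
    exact ((f.quotKerEquivRange.symm.trans (Submodule.quotEquivOfEq _ _ hker)).trans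
      g.quotKerEquivRange).length_eq
  have fN := length_quotient_ne_top_of_le hKN hKf
  have fC := length_quotient_ne_top_of_le hNC hNf'
  rw [e3] at e1
  have fM : Module.length A (Submodule.map N'.mkQ C) ≠ ⊤ := by
    intro h
    rw [h, top_add] at e1
    exact hKf e1
  unfold colength
  rw [e1, e2, ENat.toNat_add fM fN, ENat.toNat_add fM fC]
  push_cast
  ring

theorem colength_anti {I J : Ideal A} (hIJ : I ≤ J) (hI : Module.length A (A ⧸ I) ≠ ⊤) :
    colength J ≤ colength I := by
  unfold colength
  exact_mod_cast ENat.toNat_le_toNat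
    (Module.length_le_of_surjective (Submodule.factor hIJ) (Submodule.factor_surjective hIJ)) hI

theorem colength_nonneg (I : Ideal A) : 0 ≤ colength I := Int.natCast_nonneg _

theorem colength_top : colength (⊤ : Ideal A) = 0 := by
  unfold colength
  rw [Module.length_eq_zero_iff.2 (Submodule.Quotient.subsingleton_iff.2 rfl)]
  rfl

/-- The second isomorphism theorem for colengths. -/
theorem colength_inf_sub {N N' : Ideal A} (h : Module.length A (A ⧸ (N ⊓ N')) ≠ ⊤) :
    colength (N ⊓ N') - colength N = colength N' - colength (N' ⊔ N) :=
  colength_sub_eq_of_mul (N := N) (N' := N') 1 (fun x => by simp) (by simp) h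
    (length_quotient_ne_top_of_le inf_le_right h)

end Colength

/-! ### Hilbert functions of filtrations -/

section Hilbert

variable {A : Type*} [CommRing A] [IsNoetherianRing A]

/-- The theorem of Hilbert and Serre for subquotients of the associated graded ring of `m`, written
as pairs of filtrations `N' ≤ N` between `m ^ (i + 1)` and `m ^ i`: if all of `q`, modulo the span
of `Ts`, maps `N i` to `N' (i + 1)`, then the length of `N i ⧸ N' i` is eventually a polynomial
in `i` of degree less than the number of elements of `Ts`. -/
theorem eventuallyPoly_colength_sub {m q : Ideal A} (hqm : q ≤ m)
    (hred : ∃ r, ∀ i ≥ r, q * m ^ i = m ^ (i + 1))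
    (hfin : ∀ t, Module.length A (A ⧸ m ^ t) ≠ ⊤) (Ts : List A) :
    ∀ (𝔞 : Ideal A) (N N' : ℕ → Ideal A), (∀ i, m ^ (i + 1) ≤ N' i) → (∀ i, N' i ≤ N i) →
      (∀ i, N i ≤ m ^ i) → (∀ i, q * N i ≤ N (i + 1)) → (∀ i, q * N' i ≤ N' (i + 1)) →
      (∀ T ∈ Ts, T ∈ q) → (∀ i, 𝔞 * N i ≤ N' (i + 1)) → q ≤ 𝔞 ⊔ Ideal.span {x | x ∈ Ts} →
      EventuallyPoly Ts.length (fun i => colength (N' i) - colength (N i)) := by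
  induction Ts with
  | nil =>
    intro 𝔞 N N' h1 h2 h3 h4 h5 h6 h7 h8
    have hq : q ≤ 𝔞 := by simpa using h8
    let F : q.Filtration A :=
      ⟨fun i => m ^ i, fun i => Ideal.pow_le_pow_right (Nat.le_succ i), fun i => by
        rw [smul_eq_mul, pow_succ']
        exact Ideal.mul_mono_left hqm⟩
    let G : q.Filtration A :=
      ⟨N, fun i => (h3 _).trans ((h1 i).trans (h2 i)), fun i => h4 i⟩
    -- Artin–Rees: the powers of `m` form a stable `q`-filtration, hence so does the smaller
    -- filtration `N`. So `N (i + 1) = q * N i ≤ 𝔞 * N i ≤ N' (i + 1)` for large `i`.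
    have hF : F.Stable := hred
    obtain ⟨r, hr⟩ : G.Stable := hF.of_le (F' := G) (fun i => h3 i)
    refine eventually_atTop.2 ⟨r + 1, fun i hi => ?_⟩
    obtain ⟨i, rfl⟩ : ∃ j, i = j + 1 := ⟨i - 1, by omega⟩
    have e1 : q * N i = N (i + 1) := hr i (by omega)
    have e2 : N (i + 1) = N' (i + 1) :=
      le_antisymm (e1 ▸ (Ideal.mul_mono_left hq).trans (h7 i)) (h2 _)
    simp [e2]
  | cons T Ts ih =>
    intro 𝔞 N N' h1 h2 h3 h4 h5 h6 h7 h8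
    have hTq : T ∈ q := h6 T (by simp)
    have hTs : ∀ x ∈ Ts, x ∈ q := fun x hx => h6 x (by simp [hx])
    have hTq' : Ideal.span {T} ≤ q := by simpa [Ideal.span_le] using hTq
    -- Kernel `K i ⧸ N' i` and cokernel `N i ⧸ C i` of multiplication by `T` on the graded module
    -- with pieces `N i ⧸ N' i`. Both are killed by `T`, so `T` moves from the list into `𝔞`. The
    -- value `C 0 = N' 0` reflects that nothing maps to degree `0`.
    let K : ℕ → Ideal A := fun i => N i ⊓ Submodule.comap (LinearMap.lsmul A A T) (N' (i + 1))
    let C : ℕ → Ideal A := fun i =>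
      Nat.casesOn i (N' 0) (fun i => N' (i + 1) ⊔ Ideal.span {T} * N i)
    have memK : ∀ i x, x ∈ K i ↔ x ∈ N i ∧ T * x ∈ N' (i + 1) := fun i x => by
      simp [K]
    have hN'C : ∀ i, N' i ≤ C i := by
      rintro (_ | i)
      · exact le_rfl
      · exact le_sup_left
    have hCN : ∀ i, C i ≤ N i := by
      rintro (_ | i)
      · exact h2 0
      · exact sup_le (h2 _) ((Ideal.mul_mono_left hTq').trans (h4 i))
    have hN'K : ∀ i, N' i ≤ K i := fun i x hx =>
      (memK i x).2 ⟨h2 i hx, h5 i (Ideal.mul_mem_mul hTq hx)⟩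
    have h8' : q ≤ (𝔞 ⊔ Ideal.span {T}) ⊔ Ideal.span {x | x ∈ Ts} := by
      refine h8.trans (sup_le (le_sup_left.trans le_sup_left) ?_)
      rw [Ideal.span_le]
      intro x hx
      rcases List.mem_cons.1 hx with rfl | hx
      · exact Ideal.mem_sup_left (Ideal.mem_sup_right (Ideal.mem_span_singleton_self _))
      · exact Ideal.mem_sup_right (Ideal.subset_span hx)
    have hC : EventuallyPoly Ts.length (fun i => colength (C i) - colength (N i)) := by
      refine ih (𝔞 ⊔ Ideal.span {T}) N C (fun i => (h1 i).trans (hN'C i)) hCN h3 h4 ?_ hTs ?_ h8'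
      · rintro (_ | i)
        · exact (h5 0).trans (hN'C 1)
        · change q * (N' (i + 1) ⊔ Ideal.span {T} * N i) ≤ N' (i + 2) ⊔ Ideal.span {T} * N (i + 1)
          rw [Ideal.mul_sup, mul_left_comm]
          exact sup_le_sup (h5 _) (Ideal.mul_mono_right (h4 i))
      · intro i
        rw [Ideal.sup_mul]
        exact sup_le_sup (h7 i) le_rfl
    have hK : EventuallyPoly Ts.length (fun i => colength (N' i) - colength (K i)) := by
      refine ih (𝔞 ⊔ Ideal.span {T}) K N' h1 hN'K (fun i => inf_le_left.trans (h3 i)) ?_ h5 hTs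
        ?_ h8'
      · intro i
        rw [Ideal.mul_le]
        intro a ha x hx
        obtain ⟨hx1, hx2⟩ := (memK i x).1 hx
        refine (memK _ _).2 ⟨h4 i (Ideal.mul_mem_mul ha hx1), ?_⟩
        rw [mul_left_comm]
        exact h5 _ (Ideal.mul_mem_mul ha hx2)
      · intro i
        rw [Ideal.sup_mul]
        refine sup_le ((Ideal.mul_mono_right inf_le_left).trans (h7 i)) ?_
        rw [Ideal.mul_le]
        intro a ha x hx
        obtain ⟨b, rfl⟩ := Ideal.mem_span_singleton'.1 ha
        rw [mul_assoc]
        exact Ideal.mul_mem_left _ _ ((memK i x).1 hx).2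
    have fin : ∀ i (I : Ideal A), m ^ i ≤ I → Module.length A (A ⧸ I) ≠ ⊤ := fun i I hI =>
      length_quotient_ne_top_of_le hI (hfin i)
    -- The difference of the Hilbert function is the length of the cokernel in degree `i + 1` minus
    -- the length of the kernel in degree `i`.
    have key : ∀ i, (colength (N' (i + 1)) - colength (N (i + 1))) - (colength (N' i) - colength (N i))
        = (colength (C (i + 1)) - colength (N (i + 1))) - (colength (N' i) - colength (K i)) := by
      intro i
      have := colength_sub_eq_of_mul (C := C (i + 1)) T (memK i) rfl
        (fin (i + 1) _ ((h1 i).trans (hN'K i))) (fin (i + 2) _ (h1 _))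
      linarith
    rw [List.length_cons, EventuallyPoly.succ_iff]
    simp only [key]
    exact hC.shift.sub hK

end Hilbert

/-! ### Multiplicities of hypersurface sections of local domains -/

open IsLocalRing

theorem length_quotient_maximalIdeal_pow_ne_top (A : Type*) [CommRing A] [IsLocalRing A]
    [IsNoetherianRing A] (t : ℕ) : Module.length A (A ⧸ maximalIdeal A ^ t) ≠ ⊤ := by
  rcases Nat.eq_zero_or_pos t with rfl | ht
  · rw [pow_zero, Module.length_eq_zero_iff.2 (Submodule.Quotient.subsingleton_iff.2 Ideal.one_eq_top)]
    exact ENat.zero_ne_top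
  · have hmem : maximalIdeal A ∈ (maximalIdeal A ^ t).minimalPrimes :=
      ⟨⟨inferInstance, Ideal.pow_le_self ht.ne'⟩, fun q hq _ =>
        (hq.1.pow_le_iff ht.ne').1 hq.2⟩
    have := quotient_artinian_of_mem_minimalPrimes_of_isLocalRing _ hmem
    have : IsArtinian A (A ⧸ maximalIdeal A ^ t) :=
      isArtinian_of_surjective_algebraMap (R := A ⧸ maximalIdeal A ^ t)
        Ideal.Quotient.mk_surjective
    exact Module.length_ne_top

theorem length_quotient_quotient {A : Type*} [CommRing A] (L J : Ideal A) :
    Module.length (A ⧸ L) ((A ⧸ L) ⧸ J.map (Ideal.Quotient.mk L)) =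
      Module.length A (A ⧸ (L ⊔ J)) := by
  rw [← Module.length_eq_of_surjective (S := A) (R := A ⧸ L) Ideal.Quotient.mk_surjective]
  exact (DoubleQuot.quotQuotEquivQuotSupₐ A L J).toLinearEquiv.length_eq

/-- Krull's height theorem: the maximal ideal is minimal over the span of the `T i`. -/
theorem ringKrullDim_le_of_pow_le_span {A : Type*} [CommRing A] [IsLocalRing A]
    [IsNoetherianRing A] {d r : ℕ} (T : Fin d → A) (hT : ∀ i, T i ∈ maximalIdeal A)
    (h : maximalIdeal A ^ r ≤ Ideal.span (Set.range T)) : ringKrullDim A ≤ d := by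
  rw [← maximalIdeal_height_eq_ringKrullDim]
  have hmem : maximalIdeal A ∈ (Ideal.span (Set.range T)).minimalPrimes :=
    ⟨⟨inferInstance, Ideal.span_le.2 (by rintro _ ⟨i, rfl⟩; exact hT i)⟩, fun q hq _ =>
      hq.1.le_of_pow_le (h.trans hq.2)⟩
  have h1 := Ideal.height_le_card_of_mem_minimalPrimes_span (Set.finite_range T) hmem
  have h2 : (Set.range T).ncard ≤ d := by
    rw [← Set.image_univ]
    exact (Set.ncard_image_le Set.finite_univ).trans (by simp)
  exact_mod_cast h1.trans (by exact_mod_cast h2)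

/-- Artin–Rees for the ideal of `l`, followed by cancelling `l` in the domain. The shift `c` does
not depend on `t`, which is what keeps the error term in the multiplicity comparison of bounded
size. -/
theorem exists_colon_le_pow {A : Type*} [CommRing A] [IsDomain A] [IsNoetherianRing A]
    (m : Ideal A) {l : A} (hl : l ≠ 0) :
    ∃ c, ∀ t ≥ c, ∀ x, l * x ∈ m ^ t → x ∈ m ^ (t - c) := by
  obtain ⟨c, hc⟩ := m.exists_pow_inf_eq_pow_smul (Ideal.span {l})
  refine ⟨c, fun t ht x hx => ?_⟩
  have h1 : l * x ∈ m ^ t • (⊤ : Ideal A) ⊓ Ideal.span {l} :=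
    ⟨by simpa using hx, Ideal.mem_span_singleton.2 (dvd_mul_right _ _)⟩
  rw [hc t ht] at h1
  have h2 : l * x ∈ m ^ (t - c) * Ideal.span {l} := Ideal.mul_mono_right inf_le_right h1
  rw [mul_comm, Ideal.mem_span_singleton_mul] at h2
  obtain ⟨y, hy, hxy⟩ := h2
  rwa [← mul_left_cancel₀ hl hxy]

/-- Let `A` be a Noetherian local domain of dimension `d + 1` and let `l, T₁, …, T_d` generate a
reduction of the maximal ideal. Then `A` and `A ⧸ l` have the same multiplicity. -/
theorem exists_hasSamuelMultiplicity_quotient {A : Type*} [CommRing A] [IsLocalRing A]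
    [IsNoetherianRing A] [IsDomain A] {d r : ℕ} (hd : ringKrullDim A = (d + 1 : ℕ)) {l : A}
    (hl : l ∈ maximalIdeal A) (T : Fin d → A) (hT : ∀ i, T i ∈ maximalIdeal A)
    (hred : maximalIdeal A ^ (r + 1) ≤
      (Ideal.span {l} ⊔ Ideal.span (Set.range T)) * maximalIdeal A ^ r) :
    ∃ e : ℕ, ProjVar.HasSamuelMultiplicity A (maximalIdeal A) e ∧
      ProjVar.HasSamuelMultiplicity (A ⧸ Ideal.span {l})
        ((maximalIdeal A).map (Ideal.Quotient.mk (Ideal.span {l}))) e := by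
  set m := maximalIdeal A with hm
  -- Otherwise the `d` elements `T i` alone would bound the dimension by `d`.
  have hl0 : l ≠ 0 := by
    rintro rfl
    have := ringKrullDim_le_of_pow_le_span (r := r + 1) T hT
      (hred.trans (Ideal.mul_le_left.trans (by simp)))
    rw [hd] at this
    exact absurd (by exact_mod_cast this) (Nat.not_succ_le_self d)
  have hfin : ∀ t, Module.length A (A ⧸ m ^ t) ≠ ⊤ := length_quotient_maximalIdeal_pow_ne_top A
  have fin : ∀ t (I : Ideal A), m ^ t ≤ I → Module.length A (A ⧸ I) ≠ ⊤ := fun i I hI =>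
    length_quotient_ne_top_of_le hI (hfin i)
  set q : Ideal A := Ideal.span {l} ⊔ Ideal.span (Set.range T) with hq
  have hqm : q ≤ m := sup_le ((Ideal.span_singleton_le_iff_mem _).2 hl)
    (Ideal.span_le.2 (by rintro _ ⟨i, rfl⟩; exact hT i))
  have hlq : l ∈ q := Ideal.mem_sup_left (Ideal.mem_span_singleton_self _)
  have hTq : ∀ i, T i ∈ q := fun i => Ideal.mem_sup_right (Ideal.subset_span ⟨i, rfl⟩)
  have hst : ∃ r, ∀ i ≥ r, q * m ^ i = m ^ (i + 1) := by
    refine ⟨r, fun i hi => le_antisymm ?_ ?_⟩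
    · rw [pow_succ']
      exact Ideal.mul_mono_left hqm
    · obtain ⟨j, rfl⟩ := Nat.exists_eq_add_of_le hi
      rw [show r + j + 1 = (r + 1) + j by ring, pow_add, pow_add m r j, ← mul_assoc]
      exact Ideal.mul_mono_left hred
  have hTl : {x | x ∈ List.ofFn T} = Set.range T := by
    ext x
    simp [List.mem_ofFn]
  set H : ℕ → ℤ := fun t => colength (m ^ t) with hH
  -- the Hilbert-Samuel function is eventually a polynomial
  have polyH : EventuallyPoly (d + 2) H := by
    rw [EventuallyPoly.succ_iff]
    have := eventuallyPoly_colength_sub hqm hst hfin (l :: List.ofFn T) ⊥ (fun i => m ^ i)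
      (fun i => m ^ (i + 1)) (fun i => le_rfl) (fun i => Ideal.pow_le_pow_right (Nat.le_succ i))
      (fun i => le_rfl) (fun i => by rw [pow_succ']; exact Ideal.mul_mono_left hqm)
      (fun i => by rw [pow_succ' m (i + 1)]; exact Ideal.mul_mono_left hqm)
      (fun x hx => by
        rcases List.mem_cons.1 hx with rfl | hx
        · exact hlq
        · obtain ⟨i, rfl⟩ := (List.mem_ofFn).1 hx
          exact hTq i)
      (fun i => by simp)
      (by
        rw [bot_sup_eq]
        refine sup_le ?_ ?_
        · exact Ideal.span_mono (by rintro _ rfl; simp)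
        · exact Ideal.span_mono (by rintro _ ⟨i, rfl⟩; simp))
    simpa using this
  obtain ⟨c, hc⟩ := polyH.exists_eventually_eq
  have limH := tendsto_of_fwdDiff_iter_eq hc
  have limΔ : Tendsto (fun t : ℕ => (d.factorial : ℝ) * ((H (t + 1) - H t : ℤ) : ℝ) / (t : ℝ) ^ d)
      atTop (𝓝 (c : ℝ)) := tendsto_of_fwdDiff_iter_eq (f := fun t => H (t + 1) - H t) hc
  have hc0 : 0 ≤ c := by
    have : (0 : ℝ) ≤ c := ge_of_tendsto' limH fun t => by
      have : (0 : ℝ) ≤ (H t : ℝ) := by exact_mod_cast colength_nonneg _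
      positivity
    exact_mod_cast this
  obtain ⟨e, rfl⟩ := Int.eq_ofNat_of_zero_le hc0
  refine ⟨e, ⟨d + 1, hd, hfin, by simpa [hH, colength] using limH⟩, ⟨d, ?_, ?_, ?_⟩⟩
  · have := ringKrullDim_quotient_span_singleton_succ_eq_ringKrullDim_of_mem_nonZeroDivisors
      (mem_nonZeroDivisors_of_ne_zero hl0) hl
    rw [hd] at this
    push_cast at this
    exact ENat.WithBot.add_one_cancel.1 this
  · intro t
    rw [← Ideal.map_pow, length_quotient_quotient]
    exact fin t _ le_sup_right
  -- the Hilbert-Samuel function of the quotient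
  have key : ∀ t, Module.length (A ⧸ Ideal.span {l}) ((A ⧸ Ideal.span {l}) ⧸
      (m.map (Ideal.Quotient.mk (Ideal.span {l}))) ^ t) =
        Module.length A (A ⧸ (Ideal.span {l} ⊔ m ^ t)) := fun t => by
    rw [← Ideal.map_pow, length_quotient_quotient]
  simp only [key]
  set G : ℕ → ℤ := fun t => colength (Ideal.span {l} ⊔ m ^ t) with hG
  let Q : ℕ → Ideal A := fun t => Submodule.comap (LinearMap.lsmul A A l) (m ^ t)
  have memQ : ∀ t x, x ∈ Q t ↔ l * x ∈ m ^ t := fun t x => by simp [Q]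
  -- `K i ⧸ m ^ (i + 1)` is the degree `i` part of the annihilator of the class of `l` in `m ⧸ m ^
  -- 2`, inside the associated graded ring. Since `l` acts as zero on it, only the `d` elements `T
  -- i` are needed, and its length is `o(i ^ d)`.
  let K : ℕ → Ideal A := fun i => m ^ i ⊓ Q (i + 2)
  have hmQ : ∀ t, m ^ t ≤ Q (t + 1) := fun t x hx => by
    rw [memQ, pow_succ']
    exact Ideal.mul_mem_mul hl hx
  have hmQ' : ∀ t, m ^ t ≤ Q t := fun t x hx => (memQ t x).2 (Ideal.mul_mem_left _ _ hx)
  have hmK : ∀ i, m ^ (i + 1) ≤ K i := fun i =>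
    le_inf (Ideal.pow_le_pow_right (Nat.le_succ i)) (hmQ (i + 1))
  have polyK : EventuallyPoly d (fun i => colength (m ^ (i + 1)) - colength (K i)) := by
    have := eventuallyPoly_colength_sub hqm hst hfin (List.ofFn T) (Ideal.span {l}) K
      (fun i => m ^ (i + 1)) (fun i => le_rfl) hmK (fun i => inf_le_left)
      (fun i => by
        rw [Ideal.mul_le]
        intro a ha x hx
        refine ⟨?_, (memQ _ _).2 ?_⟩
        · rw [SetLike.mem_coe, pow_succ']; exact Ideal.mul_mem_mul (hqm ha) hx.1
        · rw [mul_left_comm, pow_succ']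
          exact Ideal.mul_mem_mul (hqm ha) ((memQ _ _).1 hx.2))
      (fun i => by rw [pow_succ' m (i + 1)]; exact Ideal.mul_mono_left hqm)
      (fun x hx => by
        obtain ⟨i, rfl⟩ := (List.mem_ofFn).1 hx
        exact hTq i)
      (fun i => by
        rw [Ideal.mul_le]
        intro a ha x hx
        obtain ⟨b, rfl⟩ := Ideal.mem_span_singleton'.1 ha
        rw [mul_assoc]
        exact Ideal.mul_mem_left _ _ ((memQ _ _).1 hx.2))
      (by rw [hTl])
    simpa using this
  have limK := polyK.tendsto_div_pow
  obtain ⟨s, hs⟩ := exists_colon_le_pow m hl0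
  -- `G t = H t - colength (Q t)`
  have GQ : ∀ t, G t = H t - colength (Q t) := fun t => by
    have := colength_sub_eq_of_mul (N := ⊤) (N' := m ^ t) (K := Q t) (C := Ideal.span {l} ⊔ m ^ t) l
      (fun x => by simp [memQ]) (by rw [Ideal.mul_top, sup_comm]) (fin t _ (hmQ' t)) (hfin t)
    rw [colength_top] at this
    simp only [hG, hH]
    linarith
  -- filtering `Q t ⧸ m ^ (t - 1)` by the powers of `m`
  have step : ∀ t i, i + 2 ≤ t →
      colength (Q t ⊓ m ^ (i + 1)) - colength (Q t ⊓ m ^ i) ≤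
        colength (m ^ (i + 1)) - colength (K i) := by
    intro t i hit
    have hmono : m ^ (i + 1) ≤ m ^ i := Ideal.pow_le_pow_right (Nat.le_succ i)
    have e1 : Q t ⊓ m ^ (i + 1) = (Q t ⊓ m ^ i) ⊓ m ^ (i + 1) := by
      rw [inf_assoc, inf_eq_right.2 hmono]
    have hf : m ^ t ≤ (Q t ⊓ m ^ i) ⊓ m ^ (i + 1) :=
      le_inf (le_inf (hmQ' t) (Ideal.pow_le_pow_right (by omega))) (Ideal.pow_le_pow_right (by omega))
    have e2 := colength_inf_sub (fin t _ hf)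
    have e3 : m ^ (i + 1) ⊔ (Q t ⊓ m ^ i) ≤ K i := by
      refine sup_le (hmK i) (le_inf inf_le_right (inf_le_left.trans fun x hx => ?_))
      exact (memQ _ _).2 (Ideal.pow_le_pow_right hit ((memQ _ _).1 hx))
    have e4 := colength_anti e3 (fin (i + 1) _ le_sup_left)
    rw [e1]
    linarith
  -- `Q t` lies between `m ^ (t - 1)` and `m ^ (t - 1 - s)`, so `s` steps of the filtration suffice
  -- for every `t`.
  have bound : ∀ t, s + 2 ≤ t → colength (m ^ (t - 1)) - colength (Q t) ≤
      ∑ j ∈ Finset.range s, (colength (m ^ (t - (j + 2) + 1)) - colength (K (t - (j + 2)))) := by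
    intro t ht
    have hsum : ∀ n ≤ s, colength (Q t ⊓ m ^ (t - 1)) - colength (Q t ⊓ m ^ (t - 1 - n)) ≤
        ∑ j ∈ Finset.range n, (colength (m ^ (t - (j + 2) + 1)) - colength (K (t - (j + 2)))) := by
      intro n hn
      induction n with
      | zero => simp
      | succ n ih =>
        rw [Finset.sum_range_succ]
        have h1 := ih (by omega)
        have h2 := step t (t - (n + 2)) (by omega)
        rw [show t - (n + 2) + 1 = t - 1 - n by omega] at h2 ⊢
        rw [show t - 1 - (n + 1) = t - (n + 2) by omega]
        linarith
    have h1 := hsum s le_rfl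
    have e1 : Q t ⊓ m ^ (t - 1) = m ^ (t - 1) := inf_eq_right.2 (by
      obtain ⟨t, rfl⟩ : ∃ u, t = u + 1 := ⟨t - 1, by omega⟩
      exact hmQ t)
    have e2 : Q t ⊓ m ^ (t - 1 - s) = Q t := inf_eq_left.2 fun x hx =>
      Ideal.pow_le_pow_right (by omega) (hs t (by omega) x ((memQ _ _).1 hx))
    rwa [e1, e2] at h1
  have limE : Tendsto (fun t : ℕ => ∑ j ∈ Finset.range s, (d.factorial : ℝ) *
      (((colength (m ^ (t - (j + 2) + 1)) - colength (K (t - (j + 2))) : ℤ) : ℝ) / (t : ℝ) ^ d))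
      atTop (𝓝 (∑ j ∈ Finset.range s, (d.factorial : ℝ) * 0)) :=
    tendsto_finsetSum _ fun j _ => (tendsto_div_pow_sub (g := fun i =>
      ((colength (m ^ (i + 1)) - colength (K i) : ℤ) : ℝ)) (j + 2) limK).const_mul _
  have limΔ' : Tendsto (fun t : ℕ => (d.factorial : ℝ) * ((H (t - 1 + 1) - H (t - 1) : ℤ) : ℝ) /
      (t : ℝ) ^ d) atTop (𝓝 ((e : ℤ) : ℝ)) :=
    tendsto_div_pow_sub (g := fun t => (d.factorial : ℝ) * ((H (t + 1) - H t : ℤ) : ℝ)) 1 limΔ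
  have limU := limΔ'.add limE
  simp only [mul_zero, Finset.sum_const_zero, add_zero] at limU
  rw [Int.cast_natCast] at limU limΔ'
  -- `G t` is squeezed between `H t - H (t - 1)`, whose leading term gives `e`, and the same plus
  -- the negligible sum.
  refine tendsto_of_tendsto_of_tendsto_of_le_of_le' limΔ' limU ?_ ?_
  · filter_upwards [eventually_ge_atTop 1] with t ht
    have hGt : ((Module.length A (A ⧸ (Ideal.span {l} ⊔ m ^ t))).toNat : ℝ) = (G t : ℝ) := by
      simp [hG, colength]
    rw [hGt]
    have h1 : colength (Q t) ≤ H (t - 1) := colength_anti (by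
      obtain ⟨t, rfl⟩ : ∃ u, t = u + 1 := ⟨t - 1, by omega⟩
      exact hmQ t) (hfin _)
    have h2 : H (t - 1 + 1) - H (t - 1) ≤ G t := by
      rw [GQ t, Nat.sub_add_cancel ht]
      linarith
    gcongr
  · filter_upwards [eventually_ge_atTop (s + 2)] with t ht
    have hGt : ((Module.length A (A ⧸ (Ideal.span {l} ⊔ m ^ t))).toNat : ℝ) = (G t : ℝ) := by
      simp [hG, colength]
    rw [hGt]
    have h1 := bound t ht
    have h2 : G t ≤ (H (t - 1 + 1) - H (t - 1)) + ∑ j ∈ Finset.range s,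
        (colength (m ^ (t - (j + 2) + 1)) - colength (K (t - (j + 2)))) := by
      rw [GQ t, Nat.sub_add_cancel (by omega)]
      simp only [hH] at h1 ⊢
      linarith
    have h3 : (G t : ℝ) ≤ ((H (t - 1 + 1) - H (t - 1) : ℤ) : ℝ) + ∑ j ∈ Finset.range s,
        ((colength (m ^ (t - (j + 2) + 1)) - colength (K (t - (j + 2))) : ℤ) : ℝ) := by
      exact_mod_cast h2
    rw [← Finset.mul_sum, ← Finset.sum_div, mul_div_assoc, mul_div_assoc, ← mul_add, ← add_div]
    gcongr

/-! ### Algebraic dependence -/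

open MvPolynomial in
theorem AlgebraicIndependent.le_of_isAlgebraic_range {k E : Type*} [Field k] [CommRing E] [IsDomain E]
    [Algebra k E] {ι κ : Type*} [Fintype ι] [Fintype κ] (x : ι → E)
    [Algebra.IsAlgebraic (Algebra.adjoin k (Set.range x)) E] {t : κ → E}
    (ht : AlgebraicIndependent k t) : Fintype.card κ ≤ Fintype.card ι := by
  classical
  have h1 := ht.lift_cardinalMk_le_trdeg
  have h2 : Algebra.trdeg k E ≤ _ := Algebra.IsAlgebraic.trdeg_le_cardinalMk k (Set.range x)
  have h3 : Cardinal.mk (Set.range x) ≤ (Fintype.card ι : Cardinal) := by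
    rw [Cardinal.mk_fintype]
    exact_mod_cast Fintype.card_range_le x
  have h4 := h1.trans (Cardinal.lift_le.2 (h2.trans h3))
  rw [Cardinal.mk_fintype, Cardinal.lift_natCast, Cardinal.lift_natCast] at h4
  exact_mod_cast h4

-- `B` need not be a domain, since it will be a base change of an affine domain. Without a relation,
-- the values of the nonzero polynomials at `t` form a multiplicative set avoiding `0`. Modulo a
-- prime disjoint from this set the `t` are algebraically independent, against the bound on the
-- transcendence degree.
open MvPolynomial in
theorem exists_aeval_eq_zero_of_isIntegral {K B : Type*} [Field K] [CommRing B] [Algebra K B]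
    {ι κ : Type*} [Fintype ι] [Fintype κ] (x : ι → B)
    (hx : (aeval x : MvPolynomial ι K →ₐ[K] B).toRingHom.IsIntegral) (t : κ → B)
    (h : Fintype.card ι < Fintype.card κ) :
    ∃ F : MvPolynomial κ K, F ≠ 0 ∧ aeval t F = 0 := by
  by_contra! H
  let M : Submonoid B := (nonZeroDivisors (MvPolynomial κ K)).map (aeval t : _ →ₐ[K] B)
  have hM : Disjoint ((⊥ : Ideal B) : Set B) M := by
    rw [Set.disjoint_left]
    rintro _ h0 ⟨F, hF, rfl⟩
    exact H F (nonZeroDivisors.ne_zero hF) (by simpa using h0)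
  obtain ⟨Q, hQ, -, hQM⟩ := Ideal.exists_le_prime_disjoint _ _ hM
  let π : B →ₐ[K] B ⧸ Q := Ideal.Quotient.mkₐ K Q
  have hπ : Function.Surjective π := Ideal.Quotient.mkₐ_surjective K Q
  have e1 : (aeval (π ∘ x) : MvPolynomial ι K →ₐ[K] B ⧸ Q) = π.comp (aeval x) := by
    ext i
    simp
  have int1 : (aeval (π ∘ x) : MvPolynomial ι K →ₐ[K] B ⧸ Q).toRingHom.IsIntegral := by
    rw [e1]
    exact RingHom.IsIntegral.trans _ _ hx (RingHom.isIntegral_of_surjective _ hπ)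
  have alg : Algebra.IsAlgebraic (Algebra.adjoin K (Set.range (π ∘ x))) (B ⧸ Q) := by
    rw [Algebra.adjoin_range_eq_range_aeval]
    have : Algebra.IsIntegral (aeval (π ∘ x) : MvPolynomial ι K →ₐ[K] B ⧸ Q).range (B ⧸ Q) :=
      ⟨RingHom.IsIntegral.tower_top
        (aeval (π ∘ x) : MvPolynomial ι K →ₐ[K] B ⧸ Q).rangeRestrict.toRingHom _ int1⟩
    infer_instance
  have ind : AlgebraicIndependent K (π ∘ t) := by
    rw [algebraicIndependent_iff]
    intro F hF
    by_contra hF0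
    have e2 : aeval (π ∘ t) F = π (aeval t F) := by
      rw [← AlgHom.comp_apply]
      congr 1
      ext i
      simp
    rw [e2] at hF
    exact Set.disjoint_left.1 hQM (Ideal.Quotient.eq_zero_iff_mem.1 hF)
      ⟨F, mem_nonZeroDivisors_of_ne_zero hF0, rfl⟩
  exact absurd (ind.le_of_isAlgebraic_range (π ∘ x)) (not_le.2 h)

/-! ### Reductions spanned by linear forms -/

section Reduction

/-- The linear forms `lam w`, `w ∈ W`, generate a reduction of the ideal `J` spanned by all the
linear forms `lam v`, up to higher powers of `J`. -/
def IsLinearReduction {k V B : Type*} [Field k] [AddCommGroup V] [Module k V] [CommRing B]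
    [Algebra k B] (lam : V →ₗ[k] B) (W : Submodule k V) (r : ℕ) : Prop :=
  Ideal.span (Set.range lam) ^ (r + 1) ≤
    Ideal.span (lam '' W) * Ideal.span (Set.range lam) ^ r ⊔ Ideal.span (Set.range lam) ^ (r + 2)

theorem multiset_prod_sub_mem {B : Type*} [CommRing B] {ι : Type*} (Y J : Ideal B)
    (T c : ι → B) (T₀ : B) (hT : ∀ j, T j ∈ J) (hT₀ : T₀ ∈ J)
    (hY : ∀ j, T j - c j * T₀ ∈ Y) (s : Multiset ι) :
    (s.map T).prod - (s.map c).prod * T₀ ^ Multiset.card s ∈ Y * J ^ (Multiset.card s - 1) := by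
  induction s using Multiset.induction with
  | empty => simp
  | cons j s ih =>
    simp only [Multiset.map_cons, Multiset.prod_cons, Multiset.card_cons, Nat.add_sub_cancel]
    have e : T j * (s.map T).prod - c j * (s.map c).prod * T₀ ^ (Multiset.card s + 1) =
        T j * ((s.map T).prod - (s.map c).prod * T₀ ^ Multiset.card s) +
          (T j - c j * T₀) * ((s.map c).prod * T₀ ^ Multiset.card s) := by ring
    rw [e]
    refine add_mem ?_ (Ideal.mul_mem_mul (hY j) (Ideal.mul_mem_left _ _ (Ideal.pow_mem_pow hT₀ _)))
    rcases s.empty_or_exists_mem with rfl | ⟨a, ha⟩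
    · simp
    · have hs : Multiset.card s - 1 + 1 = Multiset.card s :=
        Nat.sub_add_cancel (Multiset.card_pos_iff_exists_mem.2 ⟨a, ha⟩)
      have := Ideal.mul_mem_mul (hT j) ih
      rwa [mul_left_comm, ← pow_succ', hs] at this

-- Modulo `Y` each `T j` is `c j * T₀`, so `F(T)` becomes `F(c) * T₀ ^ δ`. Replacing one factor at a
-- time leaves `δ - 1` factors in `J`, which gives the precise error term.
open MvPolynomial in
theorem aeval_sub_mem_of_isHomogeneous {K B : Type*} [CommRing K] [CommRing B] [Algebra K B]
    {ι : Type*} {F : MvPolynomial ι K} {δ : ℕ} (hF : F.IsHomogeneous δ) (Y J : Ideal B)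
    (T : ι → B) (c : ι → K) (T₀ : B) (hT : ∀ j, T j ∈ J) (hT₀ : T₀ ∈ J)
    (hY : ∀ j, T j - algebraMap K B (c j) * T₀ ∈ Y) :
    aeval T F - algebraMap K B (eval c F) * T₀ ^ δ ∈ Y * J ^ (δ - 1) := by
  have h1 : ∀ (x : ι → B) (α : ι →₀ ℕ), (∏ i ∈ α.support, x i ^ α i) =
      ((Finsupp.toMultiset α).map x).prod := fun x α => by
    rw [Finsupp.toMultiset_map, Finsupp.prod_toMultiset, Finsupp.prod_mapDomain_index] <;>
      simp [pow_add, Finsupp.prod]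
  have h2 : algebraMap K B (eval c F) = aeval (fun i => algebraMap K B (c i)) F :=
    (aeval_algebraMap_apply B c F).symm
  rw [h2, aeval_def, aeval_def, eval₂_eq, eval₂_eq, Finset.sum_mul, ← Finset.sum_sub_distrib]
  refine Ideal.sum_mem _ fun α hα => ?_
  have hdeg : Multiset.card (Finsupp.toMultiset α) = δ := by
    rw [Finsupp.card_toMultiset, ← hF (mem_support_iff.1 hα)]
    simp [Finsupp.weight_apply, Finsupp.sum]
  have := multiset_prod_sub_mem Y J T (fun i => algebraMap K B (c i)) T₀ hT hT₀ hY
    (Finsupp.toMultiset α)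
  rw [hdeg] at this
  rw [h1, h1, mul_assoc, ← mul_sub]
  exact Ideal.mul_mem_left _ _ this

open MvPolynomial in
/-- A nonzero polynomial relation between the elements `x j` of an ideal `J` gives a nonzero form
`F` of some degree `δ` with `F x ∈ J ^ (δ + 1)`. -/
theorem exists_isHomogeneous_aeval_mem_pow {K B : Type*} [Field K] [CommRing B] [Algebra K B]
    {ι : Type*} {J : Ideal B} {x : ι → B} (hx : ∀ j, x j ∈ J) {F : MvPolynomial ι K} (hF : F ≠ 0)
    (hFx : aeval x F = 0) :
    ∃ (δ : ℕ) (G : MvPolynomial ι K), G ≠ 0 ∧ G.IsHomogeneous δ ∧ aeval x G ∈ J ^ (δ + 1) := by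
  classical
  have hmem : ∀ i, aeval x (homogeneousComponent i F) ∈ J ^ i := fun i => by
    have := aeval_sub_mem_of_isHomogeneous (homogeneousComponent_isHomogeneous i F) J J x 0 0 hx
      J.zero_mem (fun j => by simpa using hx j)
    rcases Nat.eq_zero_or_pos i with rfl | hi
    · simp
    · rw [zero_pow hi.ne', mul_zero, sub_zero, ← pow_succ', Nat.sub_add_cancel hi] at this
      exact this
  have hex : ∃ i, homogeneousComponent i F ≠ 0 := by
    by_contra! h
    apply hF
    rw [← sum_homogeneousComponent F]
    exact Finset.sum_eq_zero fun i _ => h i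
  -- The lowest nonzero component of `F`: by the relation its value is minus that of the higher
  -- components.
  refine ⟨Nat.find hex, homogeneousComponent (Nat.find hex) F, Nat.find_spec hex,
    homogeneousComponent_isHomogeneous _ _, ?_⟩
  set δ := Nat.find hex
  have hδ : δ ∈ Finset.range (F.totalDegree + 1) := by
    rw [Finset.mem_range]
    by_contra h
    exact Nat.find_spec hex (homogeneousComponent_eq_zero _ _ (by omega))
  have h0 := hFx
  rw [← sum_homogeneousComponent F, map_sum, ← Finset.add_sum_erase _ _ hδ] at h0
  rw [eq_neg_of_add_eq_zero_left h0]
  refine neg_mem (Ideal.sum_mem _ fun i hi => ?_)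
  rcases lt_or_ge i δ with h | h
  · have : homogeneousComponent i F = 0 := by
      by_contra h'
      exact Nat.find_min hex h h'
    rw [this, map_zero]
    exact zero_mem _
  · exact Ideal.pow_le_pow_right (by have := Finset.ne_of_mem_erase hi; omega) (hmem i)

theorem sup_span_singleton_pow_le {B : Type*} [CommRing B] {Y J : Ideal B} {T₀ : B} (hY : Y ≤ J)
    (hT₀ : T₀ ∈ J) (δ : ℕ) :
    (Y ⊔ Ideal.span {T₀}) ^ δ ≤ Y * J ^ (δ - 1) ⊔ Ideal.span {T₀ ^ δ} := by
  have hX : Y ⊔ Ideal.span {T₀} ≤ J := sup_le hY ((Ideal.span_singleton_le_iff_mem _).2 hT₀)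
  induction δ with
  | zero => simp
  | succ δ ih =>
    rw [pow_succ', Ideal.sup_mul, Nat.add_sub_cancel]
    refine sup_le ((Ideal.mul_mono_right (Ideal.pow_right_mono hX δ)).trans le_sup_left) ?_
    refine (Ideal.mul_mono_right ih).trans ?_
    rw [Ideal.mul_sup, pow_succ' T₀, ← Ideal.span_singleton_mul_span_singleton]
    refine sup_le_sup ?_ le_rfl
    rcases Nat.eq_zero_or_pos δ with rfl | hδ
    · simp only [zero_tsub, pow_zero, Ideal.one_eq_top, Ideal.mul_top]
      exact Ideal.mul_le_right (I := Ideal.span {T₀}) (J := Y)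
    · rw [mul_left_comm]
      refine Ideal.mul_mono_right ?_
      conv_rhs => rw [← Nat.sub_add_cancel hδ, pow_succ']
      exact Ideal.mul_mono_left ((Ideal.span_singleton_le_iff_mem _).2 hT₀)

-- One elimination step. Choose `c` over the infinite field `k` with `F(c) ≠ 0` and let `W'` be the
-- kernel of the functional `w j ↦ c j`. Modulo `W'` all `w j` are multiples of a single `w₀`, and
-- the relation `F(w) ∈ J ^ (δ + 1)` becomes `w₀ ^ δ ∈ Y * J ^ (δ - 1) ⊔ J ^ (δ + 1)`. So the `δ`-th
-- power of the ideal of `W` is absorbed by `Y`, the ideal of `W'`, up to higher powers of `J`.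
open MvPolynomial in
theorem IsLinearReduction.exists_finrank_add_one {k K V B : Type*} [Field k] [Infinite k] [Field K]
    [Algebra k K] [AddCommGroup V] [Module k V] [FiniteDimensional k V] [CommRing B] [Algebra k B]
    [Algebra K B]
    [IsScalarTower k K B] {lam : V →ₗ[k] B} {W : Submodule k V} {r e : ℕ}
    (hW : IsLinearReduction lam W r) (w : Module.Basis (Fin (e + 1)) k W) {δ : ℕ}
    {F : MvPolynomial (Fin (e + 1)) K} (hF0 : F ≠ 0) (hF : F.IsHomogeneous δ)
    (hFm : aeval (fun j => lam (w j)) F ∈ Ideal.span (Set.range lam) ^ (δ + 1)) :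
    ∃ (W' : Submodule k V) (r' : ℕ), Module.finrank k W' = e ∧ IsLinearReduction lam W' r' := by
  classical
  set J := Ideal.span (Set.range lam) with hJ
  have hlamJ : ∀ v, lam v ∈ J := fun v => Ideal.subset_span ⟨v, rfl⟩
  -- a point over `k` where `X 0 * F` does not vanish
  obtain ⟨c, hc⟩ : ∃ c : Fin (e + 1) → k, eval (fun j => algebraMap k K (c j)) (X 0 * F) ≠ 0 := by
    by_contra! h
    have : X 0 * F = 0 := by
      refine funext_set (fun _ => Set.range (algebraMap k K))
        (fun _ => Set.infinite_range_of_injective (algebraMap k K).injective) fun x hx => ?_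
      choose c hc using fun j => hx j (Set.mem_univ j)
      rw [map_zero, ← h c]
      congr 2
      ext j
      exact (hc j).symm
    exact (mul_ne_zero (X_ne_zero 0) hF0) this
  rw [map_mul, eval_X] at hc
  have hc0 : c 0 ≠ 0 := fun h => hc (by rw [h]; simp)
  have hFc : eval (fun j => algebraMap k K (c j)) F ≠ 0 := right_ne_zero_of_mul hc
  let π : W →ₗ[k] k := w.constr k c
  have hπ : ∀ j, π (w j) = c j := fun j => w.constr_basis k c j
  let w₀ : W := (c 0)⁻¹ • w 0
  have hπw₀ : π w₀ = 1 := by simp [w₀, hπ, hc0]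
  have hsurj : Function.Surjective π := fun a => ⟨a • w₀, by simp [hπw₀]⟩
  let W' : Submodule k V := (LinearMap.ker π).map W.subtype
  have hW'W : W' ≤ W := by
    rintro _ ⟨x, -, rfl⟩
    exact x.2
  have hdecomp : ∀ x : W, lam x - algebraMap k B (π x) * lam w₀ ∈ lam '' W' := fun x => by
    refine ⟨((x - π x • w₀ : W) : V), ⟨x - π x • w₀, ?_, rfl⟩, ?_⟩
    · simp [hπw₀]
    · simp [Algebra.smul_def]
  set Y := Ideal.span (lam '' W') with hY
  have hYJ : Y ≤ J := Ideal.span_mono (Set.image_subset_range _ _)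
  have hWY : Ideal.span (lam '' W) ≤ Y ⊔ Ideal.span {lam w₀} := by
    rw [Ideal.span_le]
    rintro _ ⟨x, hx, rfl⟩
    have h1 := hdecomp ⟨x, hx⟩
    have h2 : lam x = (lam x - algebraMap k B (π ⟨x, hx⟩) * lam w₀) +
      algebraMap k B (π ⟨x, hx⟩) * lam w₀ := by ring
    rw [SetLike.mem_coe, h2]
    exact add_mem (Ideal.mem_sup_left (Ideal.subset_span h1))
      (Ideal.mem_sup_right (Ideal.mul_mem_left _ _ (Ideal.mem_span_singleton_self _)))
  have hT₀ : lam w₀ ^ δ ∈ Y * J ^ (δ - 1) ⊔ J ^ (δ + 1) := by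
    have h1 := aeval_sub_mem_of_isHomogeneous hF Y J (fun j => lam (w j))
      (fun j => algebraMap k K (c j)) (lam w₀) (fun j => hlamJ _) (hlamJ _) (fun j => by
        have := hdecomp (w j)
        rw [hπ, IsScalarTower.algebraMap_apply k K B] at this
        exact Ideal.subset_span this)
    set a := eval (fun j => algebraMap k K (c j)) F
    have h2 : algebraMap K B a * lam w₀ ^ δ ∈ Y * J ^ (δ - 1) ⊔ J ^ (δ + 1) := by
      have h3 := sub_mem (Ideal.mem_sup_right (S := Y * J ^ (δ - 1)) hFm) (Ideal.mem_sup_left h1)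
      rwa [sub_sub_cancel] at h3
    have h4 := Ideal.mul_mem_left _ (algebraMap K B a⁻¹) h2
    rwa [← mul_assoc, ← map_mul, inv_mul_cancel₀ hFc, map_one, one_mul] at h4
  have hpow : Ideal.span (lam '' W) ^ δ ≤ Y * J ^ (δ - 1) ⊔ J ^ (δ + 1) :=
    (Ideal.pow_right_mono hWY δ).trans ((sup_span_singleton_pow_le hYJ (hlamJ w₀) δ).trans
      (sup_le le_sup_left ((Ideal.span_singleton_le_iff_mem _).2 hT₀)))
  have hiter : ∀ i, J ^ (r + i) ≤ Ideal.span (lam '' W) ^ i * J ^ r ⊔ J ^ (r + i + 1) := by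
    intro i
    induction i with
    | zero => simp
    | succ i ih =>
      have h1 : J ^ (r + (i + 1)) = J ^ i * J ^ (r + 1) := by rw [← pow_add]; congr 1; omega
      have hWJ : Ideal.span (lam '' W) ≤ J := Ideal.span_mono (Set.image_subset_range _ _)
      calc J ^ (r + (i + 1)) = J ^ i * J ^ (r + 1) := h1
        _ ≤ J ^ i * (Ideal.span (lam '' W) * J ^ r ⊔ J ^ (r + 2)) := Ideal.mul_mono_right hW
        _ = Ideal.span (lam '' W) * J ^ (r + i) ⊔ J ^ (r + (i + 1) + 1) := by
          rw [Ideal.mul_sup, mul_left_comm, ← pow_add, ← pow_add, add_comm i r,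
            show i + (r + 2) = r + (i + 1) + 1 by omega]
        _ ≤ Ideal.span (lam '' W) * (Ideal.span (lam '' W) ^ i * J ^ r ⊔ J ^ (r + i + 1)) ⊔
            J ^ (r + (i + 1) + 1) := sup_le_sup (Ideal.mul_mono_right ih) le_rfl
        _ ≤ _ := by
          rw [Ideal.mul_sup, ← mul_assoc, ← pow_succ']
          refine sup_le (sup_le_sup le_rfl ?_) le_sup_right
          rw [show r + (i + 1) + 1 = (r + i + 1) + 1 by omega, pow_succ' J (r + i + 1)]
          exact Ideal.mul_mono_left hWJ
  refine ⟨W', r + δ, ?_, ?_⟩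
  · rw [Submodule.finrank_map_subtype_eq]
    have h1 := LinearMap.finrank_range_add_finrank_ker π
    rw [LinearMap.range_eq_top.2 hsurj, finrank_top, Module.finrank_self,
      Module.finrank_eq_card_basis w, Fintype.card_fin] at h1
    omega
  · unfold IsLinearReduction
    rw [← hJ, ← hY]
    calc J ^ (r + δ + 1) = J * J ^ (r + δ) := pow_succ' _ _
      _ ≤ J * (Ideal.span (lam '' W) ^ δ * J ^ r ⊔ J ^ (r + δ + 1)) := Ideal.mul_mono_right (hiter δ)
      _ ≤ J * ((Y * J ^ (δ - 1) ⊔ J ^ (δ + 1)) * J ^ r ⊔ J ^ (r + δ + 1)) :=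
        Ideal.mul_mono_right (sup_le_sup (Ideal.mul_mono_left hpow) le_rfl)
      _ = Y * J ^ (1 + (δ - 1) + r) ⊔ J ^ (r + δ + 2) := by
        rw [Ideal.sup_mul, sup_assoc, ← pow_add J (δ + 1) r, show δ + 1 + r = r + δ + 1 by omega,
          sup_idem, Ideal.mul_sup, ← pow_succ', mul_assoc, mul_left_comm, ← pow_add, ← pow_succ']
        congr 3
        omega
      _ ≤ Y * J ^ (r + δ) ⊔ J ^ (r + δ + 2) :=
        sup_le_sup (Ideal.mul_mono_right (Ideal.pow_le_pow_right (by omega))) le_rfl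

open MvPolynomial in
/-- If all elements of `B` are integral over a polynomial ring in `d` variables, then there are
linear reductions spanned by `d` linear forms. -/
theorem exists_isLinearReduction {k K V B ι : Type*} [Field k] [Infinite k] [Field K]
    [Algebra k K] [AddCommGroup V] [Module k V] [FiniteDimensional k V] [CommRing B] [Algebra k B]
    [Algebra K B] [IsScalarTower k K B] [Fintype ι] (lam : V →ₗ[k] B) (x : ι → B)
    (hx : (aeval x : MvPolynomial ι K →ₐ[K] B).toRingHom.IsIntegral)
    (hV : Fintype.card ι ≤ Module.finrank k V) :
    ∃ (W : Submodule k V) (r : ℕ), Module.finrank k W = Fintype.card ι ∧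
      IsLinearReduction lam W r := by
  have H : ∀ i, Fintype.card ι + i ≤ Module.finrank k V →
      (∃ (W : Submodule k V) (r : ℕ), Module.finrank k W = Fintype.card ι + i ∧
        IsLinearReduction lam W r) → ∃ (W : Submodule k V) (r : ℕ),
          Module.finrank k W = Fintype.card ι ∧ IsLinearReduction lam W r := by
    intro i
    induction i with
    | zero => exact fun _ h => h
    | succ i ih =>
      rintro hi ⟨W, r, hW, hred⟩
      refine ih (by omega) ?_
      let w : Module.Basis (Fin (Fintype.card ι + i + 1)) k W := Module.finBasisOfFinrankEq k W hW
      obtain ⟨F, hF0, hF⟩ := exists_aeval_eq_zero_of_isIntegral x hx (fun j => lam (w j))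
        (by rw [Fintype.card_fin]; omega)
      obtain ⟨δ, G, hG0, hG, hGm⟩ := exists_isHomogeneous_aeval_mem_pow
        (J := Ideal.span (Set.range lam)) (fun j => Ideal.subset_span ⟨_, rfl⟩) hF0 hF
      exact hred.exists_finrank_add_one w hG0 hG hGm
  -- All linear forms together trivially form a reduction with `r = 0`; the dimension is then
  -- lowered one at a time.
  refine H (Module.finrank k V - Fintype.card ι) (by omega) ⟨⊤, 0, ?_, ?_⟩
  · rw [finrank_top]; omega
  · simp [IsLinearReduction]

end Reduction

/-! ### Linear forms at a moving point -/

section ShiftForm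

open MvPolynomial

variable {k σ : Type*} [Field k] [Fintype σ]

/-- The linear form `∑ uᵢ (Xᵢ - ξᵢ)` vanishing at the point `ξ`. -/
noncomputable def shiftForm {D : Type*} [CommRing D] [Algebra k D] (ξ : σ → D) :
    (σ → k) →ₗ[k] MvPolynomial σ D :=
  Fintype.linearCombination k (fun i => X i - C (ξ i))

/-- The ideal of the point `ξ`. -/
noncomputable def shiftIdeal {D : Type*} [CommRing D] (ξ : σ → D) : Ideal (MvPolynomial σ D) :=
  Ideal.span (Set.range fun i => X i - C (ξ i))

variable {D : Type*} [CommRing D] [Algebra k D]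

theorem shiftForm_apply (ξ : σ → D) (u : σ → k) :
    shiftForm ξ u = ∑ i, u i • (X i - C (ξ i)) := rfl

theorem shiftForm_mem (ξ : σ → D) (u : σ → k) : shiftForm ξ u ∈ shiftIdeal ξ := by
  rw [shiftForm_apply]
  refine sum_mem fun i _ => ?_
  rw [Algebra.smul_def]
  exact Ideal.mul_mem_left _ _ (Ideal.subset_span ⟨i, rfl⟩)

theorem map_shiftForm {D' : Type*} [CommRing D'] [Algebra k D'] (φ : D →ₐ[k] D') (ξ : σ → D)
    (u : σ → k) : map (φ : D →+* D') (shiftForm ξ u) = shiftForm (φ ∘ ξ) u := by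
  simp [shiftForm_apply, Algebra.smul_def, MvPolynomial.algebraMap_apply]

theorem map_shiftIdeal {τ D D' : Type*} [CommRing D] [CommRing D'] (φ : D →+* D') (ξ : τ → D) :
    (shiftIdeal ξ).map (MvPolynomial.map φ) = shiftIdeal (φ ∘ ξ) := by
  unfold shiftIdeal
  rw [Ideal.map_span, ← Set.range_comp]
  congr 2
  ext i
  simp

theorem span_range_shiftForm_basis {τ : Type*} [Fintype τ] (ξ : σ → D)
    (u : Module.Basis τ k (σ → k)) :
    Ideal.span (Set.range fun i => shiftForm (k := k) ξ (u i)) = shiftIdeal ξ := by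
  classical
  refine le_antisymm (Ideal.span_le.2 ?_) (Ideal.span_le.2 ?_)
  · rintro _ ⟨i, rfl⟩
    exact shiftForm_mem ξ _
  · rintro _ ⟨i, rfl⟩
    have h1 : X i - C (ξ i) = shiftForm (k := k) ξ (Pi.single i 1) := by
      rw [shiftForm_apply, Finset.sum_eq_single i]
      · simp
      · intro j _ hj
        simp [Pi.single_eq_of_ne hj]
      · simp
    simp only [SetLike.mem_coe]
    rw [h1, ← u.sum_repr (Pi.single i 1), map_sum]
    refine sum_mem fun j _ => ?_
    rw [map_smul, Algebra.smul_def]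
    exact Ideal.mul_mem_left _ _ (Ideal.subset_span ⟨j, rfl⟩)

theorem span_range_shiftForm (ξ : σ → D) :
    Ideal.span (Set.range (shiftForm (k := k) ξ)) = shiftIdeal ξ := by
  classical
  refine le_antisymm (Ideal.span_le.2 ?_) ?_
  · rintro _ ⟨i, rfl⟩
    exact shiftForm_mem ξ _
  · rw [← span_range_shiftForm_basis ξ (Pi.basisFun k σ)]
    exact Ideal.span_mono (by rintro _ ⟨i, rfl⟩; exact ⟨_, rfl⟩)

theorem sub_C_eval_mem_shiftIdeal {τ D : Type*} [CommRing D] (ξ : τ → D) (h : MvPolynomial τ D) :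
    h - C (eval ξ h) ∈ shiftIdeal ξ := by
  rw [← Ideal.Quotient.eq]
  have : (Ideal.Quotient.mk (shiftIdeal ξ)) =
      ((Ideal.Quotient.mk (shiftIdeal ξ)).comp C).comp (eval ξ) := by
    refine MvPolynomial.ringHom_ext (fun a => by simp) fun i => ?_
    rw [RingHom.comp_apply, RingHom.comp_apply, eval_X]
    exact Ideal.Quotient.eq.2 (Ideal.subset_span ⟨i, rfl⟩)
  exact congrArg (fun f : MvPolynomial τ D →+* _ => f h) this

theorem span_range_pow {B τ : Type*} [CommRing B] (f : τ → B) (r : ℕ) :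
    Ideal.span (Set.range f) ^ r = Ideal.span (Set.range fun m : Fin r → τ => ∏ t, f (m t)) := by
  induction r with
  | zero => simp [Set.range_const, Ideal.one_eq_top]
  | succ r ih =>
    rw [pow_succ', ih, Ideal.span_mul_span']
    congr 1
    ext x
    simp only [Set.mem_mul, Set.mem_range]
    constructor
    · rintro ⟨_, ⟨i, rfl⟩, _, ⟨m, rfl⟩, rfl⟩
      exact ⟨Fin.cons i m, by simp [Fin.prod_univ_succ]⟩
    · rintro ⟨m, rfl⟩
      exact ⟨_, ⟨m 0, rfl⟩, _, ⟨Fin.tail m, rfl⟩, by simp [Fin.prod_univ_succ, Fin.tail]⟩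

/-- The product of the forms `shiftForm ξ (u (m t))`. -/
noncomputable def shiftMonomial {τ : Type*} (ξ : σ → D) (u : τ → σ → k) {r : ℕ} (m : Fin r → τ) :
    MvPolynomial σ D :=
  ∏ t, shiftForm ξ (u (m t))

theorem span_range_shiftMonomial {τ : Type*} [Fintype τ] (ξ : σ → D)
    (u : Module.Basis τ k (σ → k)) (r : ℕ) :
    Ideal.span (Set.range fun m : Fin r → τ => shiftMonomial ξ u m) = shiftIdeal ξ ^ r := by
  rw [← span_range_shiftForm_basis ξ u, span_range_pow]
  rfl

theorem map_shiftMonomial {D' τ : Type*} [CommRing D'] [Algebra k D'] (φ : D →ₐ[k] D') (ξ : σ → D)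
    (u : τ → σ → k) {r : ℕ} (m : Fin r → τ) :
    map (φ : D →+* D') (shiftMonomial ξ u m) = shiftMonomial (φ ∘ ξ) u m := by
  simp [shiftMonomial, map_prod, map_shiftForm]

variable {ι κ : Type*} [Fintype ι] [Fintype κ]

/-- The relation `s Xᵢ g_m ≡ ∑ μ_{j,m'} T_j g_{m'}` modulo `I` and higher powers of the ideal of
the point `ξ`, for `Xᵢ = shiftForm ξ (u (inr i))`, `T_j = shiftForm ξ (u (inl j))` and the monomials
`g_m` of degree `r` in all these forms. -/
def ReductionRelation (I : Ideal (MvPolynomial σ D)) (ξ : σ → D) (u : ι ⊕ κ → σ → k) (r : ℕ)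
    (s : D) (i : κ) (m : Fin r → ι ⊕ κ) (μ : ι → (Fin r → ι ⊕ κ) → D) : Prop :=
  C s * (shiftForm ξ (u (Sum.inr i)) * shiftMonomial ξ u m) -
    ∑ j, ∑ m', C (μ j m') * (shiftForm ξ (u (Sum.inl j)) * shiftMonomial ξ u m') ∈
      shiftIdeal ξ ^ (r + 2) ⊔ I

theorem ReductionRelation.map {I : Ideal (MvPolynomial σ D)} {ξ : σ → D} {u : ι ⊕ κ → σ → k}
    {r : ℕ} {s : D} {i : κ} {m : Fin r → ι ⊕ κ} {μ : ι → (Fin r → ι ⊕ κ) → D}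
    (h : ReductionRelation I ξ u r s i m μ) {D' : Type*} [CommRing D'] [Algebra k D']
    (φ : D →ₐ[k] D') :
    ReductionRelation (I.map (MvPolynomial.map (φ : D →+* D'))) (φ ∘ ξ) u r (φ s) i m
      (fun j m' => φ (μ j m')) := by
  have := Ideal.mem_map_of_mem (MvPolynomial.map (φ : D →+* D')) h
  rw [Ideal.map_sup, Ideal.map_pow, map_shiftIdeal] at this
  simpa [ReductionRelation, map_shiftForm, map_shiftMonomial] using this

theorem ReductionRelation.mul_left {I : Ideal (MvPolynomial σ D)} {ξ : σ → D} {u : ι ⊕ κ → σ → k}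
    {r : ℕ} {s : D} {i : κ} {m : Fin r → ι ⊕ κ} {μ : ι → (Fin r → ι ⊕ κ) → D}
    (h : ReductionRelation I ξ u r s i m μ) (a : D) :
    ReductionRelation I ξ u r (a * s) i m (fun j m' => a * μ j m') := by
  have := Ideal.mul_mem_left _ (C a) h
  simpa only [ReductionRelation, mul_sub, Finset.mul_sum, ← mul_assoc, ← C_mul] using this

/-- Over a field `K`, the relations express that the `T_j` generate a reduction. -/
theorem exists_reductionRelation_of_le {K : Type*} [Field K] [Algebra k K]
    {I : Ideal (MvPolynomial σ K)} {ξ : σ → K} {u : Module.Basis (ι ⊕ κ) k (σ → k)} {r : ℕ}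
    (h : shiftIdeal ξ ^ (r + 1) ≤ Ideal.span (Set.range fun j => shiftForm ξ (u (Sum.inl j))) *
      shiftIdeal ξ ^ r ⊔ shiftIdeal ξ ^ (r + 2) ⊔ I) (i : κ) (m : Fin r → ι ⊕ κ) :
    ∃ μ : ι → (Fin r → ι ⊕ κ) → K, ReductionRelation I ξ u r 1 i m μ := by
  have hg : ∀ m : Fin r → ι ⊕ κ, shiftMonomial ξ u m ∈ shiftIdeal ξ ^ r := fun m => by
    rw [← span_range_shiftMonomial ξ u r]
    exact Ideal.subset_span ⟨m, rfl⟩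
  have h1 : shiftForm ξ (u (Sum.inr i)) * shiftMonomial ξ u m ∈ shiftIdeal ξ ^ (r + 1) := by
    rw [pow_succ']
    exact Ideal.mul_mem_mul (shiftForm_mem ξ _) (hg m)
  obtain ⟨y, hy, z, hz, hyz⟩ := Submodule.mem_sup.1 (sup_assoc _ _ I ▸ h h1)
  have hspan : Ideal.span (Set.range fun j => shiftForm ξ (u (Sum.inl j))) * shiftIdeal ξ ^ r =
      Ideal.span (Set.range fun p : ι × (Fin r → ι ⊕ κ) =>
        shiftForm ξ (u (Sum.inl p.1)) * shiftMonomial ξ u p.2) := by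
    rw [← span_range_shiftMonomial ξ u r, Ideal.span_mul_span']
    congr 1
    ext x
    simp [Set.mem_mul]
  rw [hspan] at hy
  obtain ⟨f, rfl⟩ := (Ideal.mem_span_range_iff_exists_fun).1 hy
  -- Constant coefficients suffice: replacing a coefficient by its value at `ξ` costs one factor in
  -- the ideal of `ξ`, so the error falls into its power `r + 2`.
  refine ⟨fun j m' => eval ξ (f (j, m')), ?_⟩
  unfold ReductionRelation
  rw [← hyz, C_1, one_mul, Fintype.sum_prod_type, add_sub_right_comm, ← Finset.sum_sub_distrib]
  refine add_mem (sum_mem fun j _ => ?_) hz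
  rw [← Finset.sum_sub_distrib]
  refine sum_mem fun m' _ => Ideal.mem_sup_left ?_
  rw [← sub_mul, show r + 2 = 1 + (1 + r) by omega, pow_add, pow_add, pow_one]
  exact Ideal.mul_mem_mul (sub_C_eval_mem_shiftIdeal ξ _)
    (Ideal.mul_mem_mul (shiftForm_mem ξ _) (hg m'))

attribute [local instance] MvPolynomial.algebraMvPolynomial in
/-- Clearing denominators in the relations. -/
theorem exists_reductionRelation_of_isFractionRing [IsDomain D] {K : Type*} [Field K] [Algebra k K]
    [Algebra D K] [IsScalarTower k D K] [IsFractionRing D K] {I : Ideal (MvPolynomial σ D)}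
    {ξ : σ → D} {u : ι ⊕ κ → σ → k} {r : ℕ} {i : κ} {m : Fin r → ι ⊕ κ}
    {μ : ι → (Fin r → ι ⊕ κ) → K}
    (h : ReductionRelation (I.map (MvPolynomial.map (algebraMap D K))) (algebraMap D K ∘ ξ) u r 1
      i m μ) :
    ∃ s ≠ (0 : D), ∃ μ' : ι → (Fin r → ι ⊕ κ) → D, ReductionRelation I ξ u r s i m μ' := by
  classical
  obtain ⟨s, hs⟩ := IsLocalization.exist_integer_multiples_of_finite (nonZeroDivisors D)
    (fun p : ι × (Fin r → ι ⊕ κ) => μ p.1 p.2)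
  choose μ' hμ' using hs
  set z : MvPolynomial σ D :=
    C (s : D) * (shiftForm ξ (u (Sum.inr i)) * shiftMonomial ξ u m) -
      ∑ j, ∑ m', C (μ' (j, m')) * (shiftForm ξ (u (Sum.inl j)) * shiftMonomial ξ u m') with hz
  let φ : D →ₐ[k] K := IsScalarTower.toAlgHom k D K
  have hφ : (φ : D →+* K) = algebraMap D K := rfl
  have h1 : algebraMap (MvPolynomial σ D) (MvPolynomial σ K) z ∈
      (shiftIdeal ξ ^ (r + 2) ⊔ I).map (algebraMap (MvPolynomial σ D) (MvPolynomial σ K)) := by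
    have h2 := h.mul_left (algebraMap D K s)
    rw [MvPolynomial.algebraMap_def, Ideal.map_sup, Ideal.map_pow, map_shiftIdeal]
    unfold ReductionRelation at h2
    convert h2 using 1
    have e1 : ∀ v, MvPolynomial.map (algebraMap D K) (shiftForm ξ v) =
      shiftForm (k := k) (algebraMap D K ∘ ξ) v := map_shiftForm φ ξ
    have e2 : ∀ m' : Fin r → ι ⊕ κ, MvPolynomial.map (algebraMap D K) (shiftMonomial ξ u m') =
      shiftMonomial (k := k) (algebraMap D K ∘ ξ) u m' := map_shiftMonomial φ ξ u
    have e3 : ∀ p, algebraMap D K (μ' p) = algebraMap D K s * μ p.1 p.2 := fun p => by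
      rw [hμ' p, Algebra.smul_def]
    simp only [hz, map_sub, map_mul, map_sum, MvPolynomial.map_C, e1, e2, e3, mul_one]
  -- After `s` has cleared the coefficients `μ`, a second denominator `t` is needed for the
  -- membership itself, as `K[X]` is the localization of `D[X]` at the nonzero constants.
  rw [IsLocalization.algebraMap_mem_map_algebraMap_iff
    ((nonZeroDivisors D).map (C : D →+* MvPolynomial σ D)) (MvPolynomial σ K)] at h1
  obtain ⟨_, ⟨t, ht, rfl⟩, htz⟩ := h1
  refine ⟨t * s, mul_ne_zero (nonZeroDivisors.ne_zero ht) (nonZeroDivisors.ne_zero s.2),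
    fun j m' => t * μ' (j, m'), ?_⟩
  have : ReductionRelation I ξ u r (t * s) i m (fun j m' => t * μ' (j, m')) := by
    simpa only [ReductionRelation, hz, mul_sub, Finset.mul_sum, ← mul_assoc, ← C_mul] using htz
  exact this

/-- Common denominators for finitely many relations. -/
theorem exists_common_reductionRelation [IsDomain D] {I : Ideal (MvPolynomial σ D)} {ξ : σ → D}
    {u : ι ⊕ κ → σ → k} {r : ℕ}
    (h : ∀ (i : κ) (m : Fin r → ι ⊕ κ), ∃ s ≠ (0 : D), ∃ μ : ι → (Fin r → ι ⊕ κ) → D,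
      ReductionRelation I ξ u r s i m μ) :
    ∃ s ≠ (0 : D), ∃ μ : κ → (Fin r → ι ⊕ κ) → ι → (Fin r → ι ⊕ κ) → D,
      ∀ i m, ReductionRelation I ξ u r s i m (μ i m) := by
  classical
  choose s hs μ hμ using h
  let S : κ × (Fin r → ι ⊕ κ) → D := fun p => s p.1 p.2
  refine ⟨∏ p, S p, Finset.prod_ne_zero_iff.2 fun p _ => hs _ _,
    fun i m j m' => (∏ p ∈ Finset.univ.erase (i, m), S p) * μ i m j m', fun i m => ?_⟩
  rw [← Finset.prod_erase_mul _ S (Finset.mem_univ (i, m))]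
  exact (hμ i m).mul_left _

end ShiftForm

/-! ### Hyperplanes which are part of a reduction at a point -/

section Good

open MvPolynomial

variable {k σ : Type*} [Field k] [Fintype σ]

/-- The form `l` is, together with `d - 1` other elements, a reduction of the maximal ideal of the
point `c` in `k[X] ⧸ P`. -/
def IsReductionMember {σ k : Type*} [CommRing k] (P : Ideal (MvPolynomial σ k)) (c : σ → k)
    (l : MvPolynomial σ k) (d : ℕ) : Prop :=
  ∃ d', d = d' + 1 ∧ ∃ (T : Fin d' → MvPolynomial σ k) (r : ℕ), (∀ i, T i ∈ shiftIdeal c) ∧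
    shiftIdeal c ^ (r + 1) ≤ (Ideal.span {l} ⊔ Ideal.span (Set.range T)) * shiftIdeal c ^ r ⊔
      shiftIdeal c ^ (r + 2) ⊔ P

/-- Combining the relations with the coefficients `β` of `l` eliminates the forms `X i` in favour of
`l` and the `T j`. -/
theorem mul_sub_sum_eq_of_forms {B κ ι γ : Type*} [CommRing B] [Fintype κ] [Fintype ι] [Fintype γ]
    (s l g : B) (X β : κ → B) (b T : ι → B) (μ : κ → ι → γ → B) (G : γ → B)
    (hl : l = ∑ j, b j * T j + ∑ i, β i * X i) :
    ∑ i, β i * (s * (X i * g) - ∑ j, ∑ m, μ i j m * (T j * G m)) =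
      s * (l * g) - ∑ j, T j * (s * b j * g + ∑ m, (∑ i, β i * μ i j m) * G m) := by
  have h1 : ∑ i, β i * X i = l - ∑ j, b j * T j := by rw [hl]; ring
  have h2 : ∑ i, β i * (s * (X i * g)) = s * ((l - ∑ j, b j * T j) * g) := by
    rw [← h1, Finset.sum_mul, Finset.mul_sum]
    exact Finset.sum_congr rfl fun i _ => by ring
  have h3 : ∑ i, β i * ∑ j, ∑ m, μ i j m * (T j * G m) =
      ∑ j, T j * ∑ m, (∑ i, β i * μ i j m) * G m := by
    simp only [Finset.mul_sum, Finset.sum_mul]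
    rw [Finset.sum_comm]
    refine Finset.sum_congr rfl fun j _ => ?_
    rw [Finset.sum_comm]
    refine Finset.sum_congr rfl fun m _ => Finset.sum_congr rfl fun i _ => by ring
  simp only [mul_sub, Finset.sum_sub_distrib, mul_add, Finset.sum_add_distrib]
  rw [h2, h3]
  have h4 : ∑ j, T j * (s * b j * g) = s * ((∑ j, b j * T j) * g) := by
    rw [Finset.sum_mul, Finset.mul_sum]
    exact Finset.sum_congr rfl fun j _ => by ring
  rw [h4]
  ring

theorem mem_of_mulVec_mem {k B γ : Type*} [Field k] [CommRing B] [Algebra k B] [Fintype γ]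
    [DecidableEq γ] (N : Matrix γ γ k) (hN : N.det ≠ 0) (v : γ → B) (b : Ideal B)
    (h : ∀ m, ∑ m', algebraMap k B (N m m') * v m' ∈ b) (m : γ) : v m ∈ b := by
  have h1 : v m = ∑ m', algebraMap k B (N⁻¹ m m') * ∑ m'', algebraMap k B (N m' m'') * v m'' := by
    have h2 : N⁻¹ * N = 1 := Matrix.nonsing_inv_mul N (isUnit_iff_ne_zero.2 hN)
    simp only [Finset.mul_sum, ← mul_assoc, ← map_mul]
    rw [Finset.sum_comm]
    simp only [← Finset.sum_mul, ← map_sum, ← Matrix.mul_apply, h2]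
    rw [Finset.sum_eq_single m]
    · simp
    · intro m' _ hm'
      simp [Matrix.one_apply_ne hm'.symm]
    · simp
  rw [h1]
  exact sum_mem fun m' _ => Ideal.mul_mem_left _ _ (h m')

/-- The matrix deciding whether a form with coordinates `β` can replace `T_j` in a reduction. -/
def replaceMatrix {D ι κ γ : Type*} [CommRing D] [Fintype κ] [DecidableEq γ] (s b : D) (β : κ → D)
    (μ : κ → γ → ι → γ → D) (j : ι) : Matrix γ γ D :=
  Matrix.of fun m m' => (if m = m' then s * b else 0) + ∑ i, β i * μ i m j m'

theorem sum_replaceMatrix_mul {D B ι κ γ : Type*} [CommRing D] [CommRing B] (f : D →+* B) [Fintype κ]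
    [Fintype γ] [DecidableEq γ] (s b : D) (β : κ → D) (μ : κ → γ → ι → γ → D) (j : ι) (t : B)
    (g : γ → B) (m : γ) :
    ∑ m', f (replaceMatrix s b β μ j m m') * (t * g m') =
      t * (f s * f b * g m + ∑ m', (∑ i, f (β i) * f (μ i m j m')) * g m') := by
  simp only [replaceMatrix, Matrix.of_apply, map_add, add_mul, Finset.sum_add_distrib, mul_add,
    map_sum, map_mul]
  congr 1
  · rw [Finset.sum_eq_single m]
    · simp only [if_true, map_mul]; ring
    · intro m' _ hm'
      simp [hm'.symm]
    · simp
  · rw [Finset.mul_sum]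
    exact Finset.sum_congr rfl fun m' _ => by ring

/-- Modulo the new form and the `T` other than `T j`, the combined relations are a square linear
system over `k` for the products `T j * g m`, with matrix `replaceMatrix`. Inverting it puts these
products into the target ideal `b`. The original relations, with `s` invertible, then give `X i * g
m ∈ b`. -/
theorem isReductionMember_of_det_ne_zero {κ : Type*} [Fintype κ] [DecidableEq κ] {d' r : ℕ}
    {P : Ideal (MvPolynomial σ k)}
    {c : σ → k} (u : Module.Basis (Fin (d' + 1) ⊕ κ) k (σ → k)) {s : k} (hs : s ≠ 0)
    {μ : κ → (Fin r → Fin (d' + 1) ⊕ κ) → Fin (d' + 1) → (Fin r → Fin (d' + 1) ⊕ κ) → k}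
    (h : ∀ i m, ReductionRelation P c u r s i m (μ i m)) (a : σ → k) (j : Fin (d' + 1))
    (hdet : (replaceMatrix s (u.repr a (Sum.inl j)) (fun i => u.repr a (Sum.inr i)) μ j).det ≠ 0) :
    IsReductionMember P c (shiftForm c a) (d' + 1) := by
  let T : Fin (d' + 1) → MvPolynomial σ k := fun j => shiftForm c (u (Sum.inl j))
  let X : κ → MvPolynomial σ k := fun i => shiftForm c (u (Sum.inr i))
  let g : (Fin r → Fin (d' + 1) ⊕ κ) → MvPolynomial σ k := fun m => shiftMonomial c u m
  refine ⟨d', rfl, fun i => T (j.succAbove i), r, fun i => shiftForm_mem c _, ?_⟩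
  set b : Ideal (MvPolynomial σ k) :=
    (Ideal.span {shiftForm c a} ⊔ Ideal.span (Set.range fun i => T (j.succAbove i))) *
      shiftIdeal c ^ r ⊔ shiftIdeal c ^ (r + 2) ⊔ P with hb
  have hg : ∀ m, g m ∈ shiftIdeal c ^ r := fun m => by
    rw [← span_range_shiftMonomial c u r]
    exact Ideal.subset_span ⟨m, rfl⟩
  have hlb : ∀ m, shiftForm c a * g m ∈ b := fun m =>
    Ideal.mem_sup_left (Ideal.mem_sup_left (Ideal.mul_mem_mul
      (Ideal.mem_sup_left (Ideal.mem_span_singleton_self _)) (hg m)))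
  have hTb : ∀ j' ≠ j, ∀ m, T j' * g m ∈ b := fun j' hj' m => by
    obtain ⟨i, rfl⟩ := Fin.exists_succAbove_eq hj'
    exact Ideal.mem_sup_left (Ideal.mem_sup_left (Ideal.mul_mem_mul
      (Ideal.mem_sup_right (Ideal.subset_span ⟨i, rfl⟩)) (hg m)))
  have hrel : ∀ i m, C s * (X i * g m) - ∑ j, ∑ m', C (μ i m j m') * (T j * g m') ∈ b :=
    fun i m => (sup_le_sup le_sup_right le_rfl :
      shiftIdeal c ^ (r + 2) ⊔ P ≤ b) (h i m)
  have hl : shiftForm c a = ∑ j, C (u.repr a (Sum.inl j)) * T j +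
      ∑ i, C (u.repr a (Sum.inr i)) * X i := by
    conv_lhs => rw [← u.sum_repr a]
    rw [map_sum, Fintype.sum_sum_type]
    simp only [map_smul]
    simp only [MvPolynomial.smul_eq_C_mul]
    rfl
  have hv : ∀ m, T j * g m ∈ b := by
    refine mem_of_mulVec_mem _ hdet (fun m => T j * g m) b fun m => ?_
    have h1 : ∑ i, C (u.repr a (Sum.inr i)) *
        (C s * (X i * g m) - ∑ j, ∑ m', C (μ i m j m') * (T j * g m')) ∈ b :=
      sum_mem fun i _ => Ideal.mul_mem_left _ _ (hrel i m)
    rw [mul_sub_sum_eq_of_forms (C s) (shiftForm c a) (g m) X _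
      (fun j => C (u.repr a (Sum.inl j))) T (fun i j m' => C (μ i m j m')) g hl] at h1
    have h2 := sub_mem (Ideal.mul_mem_left b (C s) (hlb m)) h1
    rw [sub_sub_cancel, ← Finset.add_sum_erase _ _ (Finset.mem_univ j)] at h2
    have h3 : ∑ x ∈ Finset.univ.erase j, T x * (C s * C (u.repr a (Sum.inl x)) * g m +
        ∑ m', (∑ i, C (u.repr a (Sum.inr i)) * C (μ i m x m')) * g m') ∈ b := by
      refine sum_mem fun x hx => ?_
      have hx := Finset.ne_of_mem_erase hx
      rw [mul_add, mul_left_comm, Finset.mul_sum]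
      refine add_mem (Ideal.mul_mem_left _ _ (hTb x hx m)) (sum_mem fun m' _ => ?_)
      rw [mul_left_comm]
      exact Ideal.mul_mem_left _ _ (hTb x hx m')
    have h4 := sub_mem h2 h3
    rw [add_sub_cancel_right] at h4
    rwa [← sum_replaceMatrix_mul (C : k →+* MvPolynomial σ k)] at h4
  have hTall : ∀ j' m, T j' * g m ∈ b := fun j' m => by
    by_cases hj' : j' = j
    · exact hj' ▸ hv m
    · exact hTb j' hj' m
  have hX : ∀ i m, X i * g m ∈ b := fun i m => by
    have h1 : C s * (X i * g m) ∈ b := by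
      have := add_mem (hrel i m) (sum_mem fun j' (_ : j' ∈ Finset.univ) =>
        sum_mem fun m' (_ : m' ∈ Finset.univ) => Ideal.mul_mem_left b (C (μ i m j' m')) (hTall j' m'))
      rwa [sub_add_cancel] at this
    have := Ideal.mul_mem_left b (C s⁻¹) h1
    rwa [← mul_assoc, ← C_mul, inv_mul_cancel₀ hs, C_1, one_mul] at this
  rw [pow_succ', ← span_range_shiftMonomial c u r, ← span_range_shiftForm_basis c u,
    Ideal.span_mul_span', Ideal.span_le]
  rintro _ ⟨_, ⟨z, rfl⟩, _, ⟨m, rfl⟩, rfl⟩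
  rcases z with j' | i
  · exact hTall j' m
  · exact hX i m

end Good

/-! ### The generic point of a subvariety -/

section Generic

open MvPolynomial

/-- A Noether normalization over `k` stays integral over `K`: constants come from the base, and the
equations of the variables are carried along. This bounds the number of independent elements even
though the base change of `P` need not be prime. -/
theorem isIntegral_aeval_quotient_map {k σ ι : Type*} [Field k] {P : Ideal (MvPolynomial σ k)}
    {y : ι → MvPolynomial σ k} (hy : (aeval (fun i => Ideal.Quotient.mk P (y i)) :
      MvPolynomial ι k →ₐ[k] MvPolynomial σ k ⧸ P).toRingHom.IsIntegral)
    (K : Type*) [Field K] [Algebra k K] :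
    (aeval (fun i => Ideal.Quotient.mk (P.map (MvPolynomial.map (algebraMap k K)))
      (MvPolynomial.map (algebraMap k K) (y i))) :
      MvPolynomial ι K →ₐ[K] MvPolynomial σ K ⧸
        P.map (MvPolynomial.map (algebraMap k K))).toRingHom.IsIntegral := by
  set IK : Ideal (MvPolynomial σ K) := P.map (MvPolynomial.map (algebraMap k K)) with hIK
  set yK : ι → MvPolynomial σ K ⧸ IK :=
    fun i => Ideal.Quotient.mk IK (MvPolynomial.map (algebraMap k K) (y i)) with hyK
  let θ : (MvPolynomial σ k ⧸ P) →+* MvPolynomial σ K ⧸ IK :=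
    Ideal.quotientMap IK (MvPolynomial.map (algebraMap k K)) Ideal.le_comap_map
  have hθ : θ.comp (aeval (fun i => Ideal.Quotient.mk P (y i)) :
      MvPolynomial ι k →ₐ[k] MvPolynomial σ k ⧸ P).toRingHom =
      (aeval yK : MvPolynomial ι K →ₐ[K] MvPolynomial σ K ⧸ IK).toRingHom.comp
        (MvPolynomial.map (algebraMap k K)) := by
    refine MvPolynomial.ringHom_ext (fun a => ?_) fun i => ?_
    · simp only [RingHom.comp_apply, AlgHom.toRingHom_eq_coe, RingHom.coe_coe, map_C, aeval_C]
      change θ (Ideal.Quotient.mk P (C a)) = Ideal.Quotient.mk IK (C (algebraMap k K a))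
      rw [Ideal.quotientMap_mk, map_C]
    · simp only [RingHom.comp_apply, AlgHom.toRingHom_eq_coe, RingHom.coe_coe, map_X, aeval_X,
        hyK]
      rw [Ideal.quotientMap_mk]
  intro b
  obtain ⟨p, rfl⟩ := Ideal.Quotient.mk_surjective b
  induction p using MvPolynomial.induction_on with
  | C a =>
    have := (aeval yK : MvPolynomial ι K →ₐ[K] _).toRingHom.isIntegralElem_map (x := C a)
    rw [AlgHom.toRingHom_eq_coe, RingHom.coe_coe, aeval_C] at this
    exact this
  | add p q hp hq =>
    rw [map_add]
    exact RingHom.IsIntegralElem.add _ hp hq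
  | mul_X p i hp =>
    rw [map_mul]
    refine RingHom.IsIntegralElem.mul _ hp ?_
    have := (hy (Ideal.Quotient.mk P (X i))).map θ
    rw [hθ] at this
    have := RingHom.IsIntegralElem.of_comp this
    rwa [Ideal.quotientMap_mk, map_X] at this

theorem exists_shiftIdeal_pow_le {k σ ι K : Type*} [Field k] [Infinite k] [Fintype σ]
    [Fintype ι] [Field K] [Algebra k K] {IK : Ideal (MvPolynomial σ K)}
    {yK : ι → MvPolynomial σ K ⧸ IK}
    (hint : (aeval yK : MvPolynomial ι K →ₐ[K] MvPolynomial σ K ⧸ IK).toRingHom.IsIntegral)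
    (hcard : Fintype.card ι ≤ Fintype.card σ) (ξ : σ → K) :
    ∃ (e : ℕ) (u : Module.Basis (ι ⊕ Fin e) k (σ → k)) (r : ℕ),
      shiftIdeal ξ ^ (r + 1) ≤ Ideal.span (Set.range fun j => shiftForm ξ (u (Sum.inl j))) *
        shiftIdeal ξ ^ r ⊔ shiftIdeal ξ ^ (r + 2) ⊔ IK := by
  let B := MvPolynomial σ K ⧸ IK
  let lam : (σ → k) →ₗ[k] B := (Ideal.Quotient.mkₐ k IK).toLinearMap ∘ₗ shiftForm ξ
  have hlam : ∀ v, lam v = Ideal.Quotient.mk IK (shiftForm ξ v) := fun v => rfl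
  obtain ⟨W, r, hW, hred⟩ := exists_isLinearReduction (K := K) lam yK hint
    (by rwa [Module.finrank_fintype_fun_eq_card])
  obtain ⟨W', hWW'⟩ := Submodule.exists_isCompl W
  let bW : Module.Basis ι k W := (Module.finBasisOfFinrankEq k W hW).reindex
    (Fintype.equivFin ι).symm
  let u : Module.Basis (ι ⊕ Fin (Module.finrank k W')) k (σ → k) :=
    (bW.prod (Module.finBasis k W')).map (Submodule.prodEquivOfIsCompl W W' hWW')
  have hu : ∀ j, u (Sum.inl j) = bW j := fun j => by simp [u]
  have hT : Ideal.span (lam '' W) = (Ideal.span (Set.range fun j =>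
      shiftForm ξ (u (Sum.inl j)))).map (Ideal.Quotient.mk IK) := by
    rw [Ideal.map_span, ← Set.range_comp]
    refine le_antisymm (Ideal.span_le.2 ?_) (Ideal.span_le.2 ?_)
    · rintro _ ⟨w, hw, rfl⟩
      have h1 : lam w = ∑ j, bW.repr ⟨w, hw⟩ j • lam (bW j) := by
        conv_lhs => rw [show w = W.subtype ⟨w, hw⟩ from rfl, ← bW.sum_repr ⟨w, hw⟩]
        simp only [map_sum, map_smul]
        rfl
      rw [SetLike.mem_coe, h1]
      refine sum_mem fun j _ => ?_
      refine Submodule.smul_of_tower_mem _ _ (Ideal.subset_span ⟨j, ?_⟩)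
      simp only [Function.comp_apply, hu, hlam]
    · rintro _ ⟨j, rfl⟩
      refine Ideal.subset_span ⟨bW j, (bW j).2, ?_⟩
      simp only [Function.comp_apply, hu, hlam]
  have hJ : Ideal.span (Set.range lam) = (shiftIdeal ξ).map (Ideal.Quotient.mk IK) := by
    rw [← span_range_shiftForm (k := k), Ideal.map_span, ← Set.range_comp]
    rfl
  refine ⟨_, u, r, ?_⟩
  unfold IsLinearReduction at hred
  rw [hT, hJ, ← Ideal.map_pow, ← Ideal.map_pow, ← Ideal.map_pow, ← Ideal.map_mul,
    ← Ideal.map_sup, Ideal.map_le_iff_le_comap, Ideal.comap_map_of_surjective' _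
      Ideal.Quotient.mk_surjective, Ideal.mk_ker] at hred
  exact hred

/-- Over the fraction field of `D` the tuple `ξ` is a rational point, so a reduction by linear forms
with coefficients in `k` exists there. Its finitely many relations descend to `D` with one common
denominator `s`. -/
theorem exists_reductionRelation_generic {k σ ι : Type*} [Field k] [Infinite k] [Fintype σ]
    [Fintype ι] {P : Ideal (MvPolynomial σ k)} (y : ι → MvPolynomial σ k)
    (hy : (aeval (fun i => Ideal.Quotient.mk P (y i)) :
      MvPolynomial ι k →ₐ[k] MvPolynomial σ k ⧸ P).toRingHom.IsIntegral)
    (hcard : Fintype.card ι ≤ Fintype.card σ)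
    {D : Type*} [CommRing D] [IsDomain D] [Algebra k D] (ξ : σ → D) :
    ∃ (e : ℕ) (u : Module.Basis (ι ⊕ Fin e) k (σ → k)) (r : ℕ) (s : D),
      s ≠ 0 ∧ ∃ μ : Fin e → (Fin r → ι ⊕ Fin e) → ι → (Fin r → ι ⊕ Fin e) → D,
        ∀ i m, ReductionRelation (P.map (MvPolynomial.map (algebraMap k D))) ξ u r s i m
        (μ i m) := by
  classical
  let K := FractionRing D
  obtain ⟨e, u, r, hred⟩ := exists_shiftIdeal_pow_le (k := k) (isIntegral_aeval_quotient_map hy K) hcard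
    (algebraMap D K ∘ ξ)
  have hIK : (P.map (MvPolynomial.map (algebraMap k D))).map
      (MvPolynomial.map (algebraMap D K)) = P.map (MvPolynomial.map (algebraMap k K)) := by
    rw [Ideal.map_map]
    congr 1
    refine MvPolynomial.ringHom_ext (fun a => ?_) fun i => by simp
    simp [← IsScalarTower.algebraMap_apply k D K]
  obtain ⟨s, hs, μ, hμ⟩ := exists_common_reductionRelation (u := u) (r := r) (ξ := ξ)
    (I := P.map (MvPolynomial.map (algebraMap k D))) fun i m => by
      obtain ⟨μ, hμ⟩ := exists_reductionRelation_of_le hred i m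
      rw [← hIK] at hμ
      exact exists_reductionRelation_of_isFractionRing hμ
  exact ⟨_, u, r, s, hs, μ, hμ⟩

end Generic

/-! ### The hyperplanes which are not part of a reduction -/

section Dependence

open MvPolynomial

/-- The determinants of the matrices `replaceMatrix` for indeterminate coordinates. -/
noncomputable def replaceDet {D ι κ γ : Type*} [CommRing D] [Fintype κ] [Fintype γ] [DecidableEq γ]
    (s : D) (μ : κ → γ → ι → γ → D) (j : ι) : MvPolynomial (ι ⊕ κ) D :=
  (replaceMatrix (C s) (X (Sum.inl j)) (fun i => X (Sum.inr i)) (fun i m j m' => C (μ i m j m'))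
    j).det

theorem eval₂Hom_replaceDet {D E ι κ γ : Type*} [CommRing D] [CommRing E] [Fintype κ] [Fintype γ]
    [DecidableEq γ] (s : D) (μ : κ → γ → ι → γ → D) (f : D →+* E) (b : ι ⊕ κ → E) (j : ι) :
    eval₂Hom f b (replaceDet s μ j) = (replaceMatrix (f s) (b (Sum.inl j)) (fun i => b (Sum.inr i))
      (fun i m j m' => f (μ i m j m')) j).det := by
  unfold replaceDet
  rw [RingHom.map_det]
  congr 1
  ext m m'
  simp only [replaceMatrix, RingHom.mapMatrix_apply, Matrix.map_apply, Matrix.of_apply, map_add,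
    map_sum, map_mul, apply_ite (eval₂Hom f b), map_zero, eval₂Hom_C, eval₂Hom_X']

/-- As a polynomial in `v`, the determinant has leading coefficient a power of `s`, since `v` enters
only through the scalar matrix `s * v`. -/
theorem isAlgebraic_of_replaceMatrix_det_eq_zero {A E ι κ γ : Type*} [CommRing A] [IsDomain A]
    [CommRing E] [Algebra A E] [Fintype κ] [Fintype γ] [DecidableEq γ] {s : A} (hs : s ≠ 0)
    (β : κ → A) (μ : κ → γ → ι → γ → A) (j : ι) (v : E)
    (h : (replaceMatrix (algebraMap A E s) v (fun i => algebraMap A E (β i))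
      (fun i m j m' => algebraMap A E (μ i m j m')) j).det = 0) : IsAlgebraic A v := by
  let N : Matrix γ γ A := Matrix.of fun m m' => ∑ i, β i * μ i m j m'
  refine ⟨(((Polynomial.X : Polynomial A) • (s • (1 : Matrix γ γ A)).map Polynomial.C +
    N.map Polynomial.C).det), fun h0 => ?_, ?_⟩
  · have := Polynomial.coeff_det_X_add_C_card (s • (1 : Matrix γ γ A)) N
    rw [h0, Polynomial.coeff_zero, Matrix.det_smul, Matrix.det_one, mul_one] at this
    exact pow_ne_zero _ hs this.symm
  · rw [AlgHom.map_det, ← h]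
    congr 1
    ext m m'
    by_cases hm : m = m'
    · subst hm
      simp only [N, replaceMatrix, AlgHom.mapMatrix_apply, Matrix.map_apply, Matrix.add_apply,
        Matrix.smul_apply, Matrix.of_apply, Matrix.one_apply_eq, smul_eq_mul, mul_one, map_add,
        map_mul, Polynomial.aeval_X, Polynomial.aeval_C, map_sum, if_true, mul_comm v]
    · simp only [N, replaceMatrix, AlgHom.mapMatrix_apply, Matrix.map_apply, Matrix.add_apply,
        Matrix.smul_apply, Matrix.of_apply, Matrix.one_apply_ne hm, smul_eq_mul, mul_zero, map_add,
        map_mul, map_zero, Polynomial.aeval_C, map_sum, if_neg hm]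

theorem IsAlgebraic.of_replaceMatrix_det_eq_zero {A E ι κ γ : Type*} [CommRing A] [IsDomain A]
    [CommRing E] [IsDomain E] [Algebra A E] [Fintype κ] [Fintype γ] [DecidableEq γ] {s : E}
    (hs : s ≠ 0) (hsA : IsAlgebraic A s) {β : κ → E} (hβ : ∀ i, IsAlgebraic A (β i))
    {μ : κ → γ → ι → γ → E} (hμ : ∀ i m j m', IsAlgebraic A (μ i m j m')) {j : ι} {v : E}
    (h : (replaceMatrix s v β μ j).det = 0) : IsAlgebraic A v := by
  have : IsAlgebraic (Subalgebra.algebraicClosure A E) v :=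
    isAlgebraic_of_replaceMatrix_det_eq_zero (s := (⟨s, hsA⟩ : Subalgebra.algebraicClosure A E))
      (fun h => hs (congrArg Subtype.val h)) (fun i => ⟨β i, hβ i⟩)
      (fun i m j m' => ⟨μ i m j m', hμ i m j m'⟩) j v h
  exact this.restrictScalars A

/-- The dimension count. If it failed, some prime `Q` would contain all determinants and avoid both
the nonzero constants from `D` and the nonzero polynomials in `z`. In the quotient domain the `z`
are algebraically independent, yet everything is algebraic over the images of `x` and the
coordinates in `κ`, which are too few. -/
theorem exists_mul_aeval_mem_span_replaceDet {k D ι κ γ τ : Type*} [Field k] [CommRing D]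
    [IsDomain D] [Algebra k D] [Fintype ι] [Fintype κ] [Fintype γ] [DecidableEq γ] [Fintype τ]
    {x : ι → D} (hx : (aeval x : MvPolynomial ι k →ₐ[k] D).toRingHom.IsIntegral) {s : D}
    (hs : s ≠ 0) (μ : κ → γ → ι → γ → D) (z : τ → MvPolynomial (ι ⊕ κ) D)
    (hcard : Fintype.card ι + Fintype.card κ < Fintype.card τ) :
    ∃ Φ : MvPolynomial τ k, Φ ≠ 0 ∧ ∃ t : D, t ≠ 0 ∧
      C t * aeval z Φ ∈ Ideal.span (Set.range (replaceDet s μ)) := by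
  by_contra! H
  let M : Submonoid (MvPolynomial (ι ⊕ κ) D) :=
    (nonZeroDivisors D).map (C : D →+* MvPolynomial (ι ⊕ κ) D) ⊔
      (nonZeroDivisors (MvPolynomial τ k)).map (aeval z : _ →ₐ[k] MvPolynomial (ι ⊕ κ) D)
  have hM : Disjoint ((Ideal.span (Set.range (replaceDet s μ)) : Ideal _) :
      Set (MvPolynomial (ι ⊕ κ) D)) M := by
    rw [Set.disjoint_left]
    rintro p hp hpM
    obtain ⟨_, ⟨t, ht, rfl⟩, _, ⟨Φ, hΦ, rfl⟩, rfl⟩ := Submonoid.mem_sup.1 hpM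
    exact H Φ (nonZeroDivisors.ne_zero hΦ) t (nonZeroDivisors.ne_zero ht) hp
  obtain ⟨Q, hQ, hGQ, hQM⟩ := Ideal.exists_le_prime_disjoint _ _ hM
  let E := MvPolynomial (ι ⊕ κ) D ⧸ Q
  let q : MvPolynomial (ι ⊕ κ) D →ₐ[k] E := Ideal.Quotient.mkₐ k Q
  have hq0 : ∀ p, q p = 0 ↔ p ∈ Q := fun p => Ideal.Quotient.eq_zero_iff_mem
  have hqC : ∀ t ≠ 0, q (C t) ≠ 0 := fun t ht h =>
    Set.disjoint_left.1 hQM ((hq0 _).1 h)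
      (Submonoid.mem_sup_left ⟨t, mem_nonZeroDivisors_of_ne_zero ht, rfl⟩)
  have ind : AlgebraicIndependent k (q ∘ z) := by
    rw [algebraicIndependent_iff]
    intro F hF
    by_contra hF0
    have e2 : aeval (q ∘ z) F = q (aeval z F) := by
      rw [← AlgHom.comp_apply]
      congr 1
      ext i
      simp
    rw [e2] at hF
    exact Set.disjoint_left.1 hQM ((hq0 _).1 hF)
      (Submonoid.mem_sup_right ⟨F, mem_nonZeroDivisors_of_ne_zero hF0, rfl⟩)
  let w : ι ⊕ κ → E := Sum.elim (fun j => q (C (x j))) (fun i => q (X (Sum.inr i)))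
  let A := Algebra.adjoin k (Set.range w)
  let S : Subalgebra A E := Subalgebra.algebraicClosure A E
  have hwA : ∀ v, w v ∈ A := fun v => Algebra.subset_adjoin ⟨v, rfl⟩
  have hCS : ∀ d, q (C d) ∈ S := fun d => by
    let g : MvPolynomial ι k →ₐ[k] A := aeval fun j => ⟨w (Sum.inl j), hwA _⟩
    let qC : D →ₐ[k] E := q.comp (IsScalarTower.toAlgHom k D (MvPolynomial (ι ⊕ κ) D))
    have h1 : qC.toRingHom.comp (aeval x : MvPolynomial ι k →ₐ[k] D).toRingHom =
        (algebraMap A E).comp g.toRingHom := by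
      have : qC.comp (aeval x : MvPolynomial ι k →ₐ[k] D) =
          (IsScalarTower.toAlgHom k A E).comp g := by
        ext j
        simp only [AlgHom.comp_apply, aeval_X, g]
        rfl
      exact congrArg AlgHom.toRingHom this
    have h2 := (hx d).map qC.toRingHom
    rw [h1] at h2
    have h3 : IsIntegral A (q (C d)) := h2.of_comp
    exact h3.isAlgebraic
  have hrS : ∀ i, q (X (Sum.inr i)) ∈ S := fun i =>
    isAlgebraic_algebraMap (A := E) (⟨_, hwA (Sum.inr i)⟩ : A)
  -- The `j`-th determinant vanishes modulo `Q` and involves no other coordinate of type `ι`, so the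
  -- coordinates can be treated separately.
  have hlS : ∀ j, q (X (Sum.inl j)) ∈ S := fun j => by
    have h2 : q (replaceDet s μ j) = 0 := (hq0 _).2 (hGQ (Ideal.subset_span ⟨j, rfl⟩))
    have h3 : (q : MvPolynomial (ι ⊕ κ) D →+* E) =
        eval₂Hom ((q : MvPolynomial (ι ⊕ κ) D →+* E).comp C) (fun v => q (X v)) :=
      MvPolynomial.ringHom_ext (fun a => by simp) fun v => by simp
    have h4 := eval₂Hom_replaceDet s μ ((q : MvPolynomial (ι ⊕ κ) D →+* E).comp C)
      (fun v => q (X v)) j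
    rw [← h3] at h4
    exact IsAlgebraic.of_replaceMatrix_det_eq_zero (hqC s hs) (hCS s) hrS
      (fun i m j m' => hCS (μ i m j m')) (h4.symm.trans h2)
  have hS : ∀ p, q p ∈ S := fun p => by
    induction p using MvPolynomial.induction_on with
    | C a => exact hCS a
    | add p p' hp hp' => rw [map_add]; exact add_mem hp hp'
    | mul_X p v hp =>
      rw [map_mul]
      refine mul_mem hp ?_
      rcases v with j | i
      · exact hlS j
      · exact hrS i
  have alg : Algebra.IsAlgebraic A E := ⟨fun e => by
    obtain ⟨p, rfl⟩ := Ideal.Quotient.mk_surjective e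
    exact hS p⟩
  have := ind.le_of_isAlgebraic_range w
  rw [Fintype.card_sum] at this
  omega

end Dependence

/-! ### Generic hyperplanes through the points of an affine variety -/

section Affine

open MvPolynomial

/-- For all `(a₀, a)` outside of the zero locus of some `Φ ≠ 0`, the hyperplane
`a₀ + ∑ aᵢ Xᵢ = 0` is part of a reduction of the maximal ideal of `k[X] ⧸ P` at each of its points
`c` that satisfies `p`. -/
def GenericallyReductionMember {k σ : Type*} [Field k] [Fintype σ] (P : Ideal (MvPolynomial σ k))
    (d : ℕ) (p : (σ → k) → Prop) : Prop :=
  ∃ Φ : MvPolynomial (Option σ) k, Φ ≠ 0 ∧ ∀ c, p c → ∀ (a₀ : k) (a : σ → k),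
    a₀ + ∑ i, a i * c i = 0 → eval (fun o => o.elim a₀ a) Φ ≠ 0 →
      IsReductionMember P c (shiftForm c a) d

variable {k σ : Type*} [Field k] [Fintype σ] {P : Ideal (MvPolynomial σ k)} {d : ℕ}

theorem GenericallyReductionMember.or {p p' q : (σ → k) → Prop}
    (h : GenericallyReductionMember P d p) (h' : GenericallyReductionMember P d p')
    (hq : ∀ c, q c → p c ∨ p' c) : GenericallyReductionMember P d q := by
  obtain ⟨Φ, hΦ, H⟩ := h
  obtain ⟨Φ', hΦ', H'⟩ := h'
  refine ⟨Φ * Φ', mul_ne_zero hΦ hΦ', fun c hc a₀ a ha hne => ?_⟩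
  rw [map_mul] at hne
  rcases hq c hc with h | h
  · exact H c h a₀ a ha (left_ne_zero_of_mul hne)
  · exact H' c h a₀ a ha (right_ne_zero_of_mul hne)

theorem isIntegral_aeval_quotient_of_le {k σ ι : Type*} [Field k] {P : Ideal (MvPolynomial σ k)}
    {y : ι → MvPolynomial σ k}
    (hy : (aeval (fun i => Ideal.Quotient.mk P (y i)) :
      MvPolynomial ι k →ₐ[k] MvPolynomial σ k ⧸ P).toRingHom.IsIntegral)
    {Q : Ideal (MvPolynomial σ k)} (hPQ : P ≤ Q) :
    (aeval (fun i => Ideal.Quotient.mk Q (y i)) :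
      MvPolynomial ι k →ₐ[k] MvPolynomial σ k ⧸ Q).toRingHom.IsIntegral := by
  have h : (aeval (fun i => Ideal.Quotient.mk Q (y i)) :
      MvPolynomial ι k →ₐ[k] MvPolynomial σ k ⧸ Q) = (Ideal.Quotient.factorₐ k hPQ).comp
        (aeval (fun i => Ideal.Quotient.mk P (y i))) := by
    ext i
    simp
  rw [h]
  exact RingHom.IsIntegral.trans _ _ hy
    (RingHom.isIntegral_of_surjective _ (Ideal.Quotient.factor_surjective hPQ))

/-- The relations at the generic point of `V(Q)` specialize wherever the chosen `f` does not vanish.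
There a hyperplane with `Φ ≠ 0` cannot annihilate all determinants. -/
theorem exists_generic_stratum [Infinite k] {y : Fin d → MvPolynomial σ k}
    (hy : (aeval (fun i => Ideal.Quotient.mk P (y i)) :
      MvPolynomial (Fin d) k →ₐ[k] MvPolynomial σ k ⧸ P).toRingHom.IsIntegral)
    (hcard : d ≤ Fintype.card σ) {Q : Ideal (MvPolynomial σ k)} [Q.IsPrime] (hPQ : P ≤ Q) :
    ∃ f ∉ Q, GenericallyReductionMember P d
      fun c => (∀ g ∈ Q, eval c g = 0) ∧ eval c f ≠ 0 := by
  classical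
  let D := MvPolynomial σ k ⧸ Q
  let ξ : σ → D := fun i => Ideal.Quotient.mk Q (X i)
  obtain ⟨e, u, r, s, hs, μ, hμ⟩ := exists_reductionRelation_generic y hy
    (by rwa [Fintype.card_fin]) ξ
  let zs : σ → MvPolynomial (Fin d ⊕ Fin e) D := fun i => ∑ v, X v * C (algebraMap k D (u v i))
  -- Coefficients of the general hyperplane through the generic point; the constant term is forced
  -- by the incidence.
  let z : Option σ → MvPolynomial (Fin d ⊕ Fin e) D :=
    fun o => o.elim (-∑ i, zs i * C (ξ i)) zs
  have hcard' : Fintype.card (Fin d) + Fintype.card (Fin e) < Fintype.card (Option σ) := by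
    rw [Fintype.card_option, ← Fintype.card_sum, ← Module.finrank_eq_card_basis u,
      Module.finrank_fintype_fun_eq_card]
    exact Nat.lt_succ_self _
  obtain ⟨Φ, hΦ, t, ht, hmem⟩ := exists_mul_aeval_mem_span_replaceDet
    (isIntegral_aeval_quotient_of_le hy hPQ) hs μ z hcard'
  -- `s` must stay invertible for the relations and `t` for the membership of `Φ(z)`.
  obtain ⟨f, hf⟩ := Ideal.Quotient.mk_surjective (s * t)
  refine ⟨f, fun hfQ => mul_ne_zero hs ht (hf ▸ Ideal.Quotient.eq_zero_iff_mem.2 hfQ), Φ, hΦ, ?_⟩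
  rintro c ⟨hcQ, hcf⟩ a₀ a ha hne
  let π : D →ₐ[k] k := Ideal.Quotient.liftₐ Q (aeval c) fun g hg => by
    rw [← hcQ g hg]; rfl
  have hπ : ∀ g, π (Ideal.Quotient.mk Q g) = eval c g := fun g => rfl
  rw [← hπ, hf, map_mul] at hcf
  have hπξ : π ∘ ξ = c := funext fun i => by simp [ξ, hπ]
  let b : Fin d ⊕ Fin e → k := fun v => u.repr a v
  have hab : ∀ i, ∑ v, b v * u v i = a i := fun i => by
    conv_rhs => rw [← u.sum_repr a]
    simp [b]
  let ev : MvPolynomial (Fin d ⊕ Fin e) D →+* k := eval₂Hom (π : D →+* k) b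
  have hevs : ∀ i, ev (zs i) = a i := fun i => by
    rw [← hab i]
    simp [ev, zs]
  have hevz : ∀ o, ev (z o) = o.elim a₀ a := fun o => by
    rcases o with _ | i
    · have h1 : ∀ i, ev (C (ξ i)) = c i := fun i => by
        rw [← hπξ]; simp [ev]
      simp only [z, Option.elim_none, map_neg, map_sum, map_mul, hevs, h1]
      exact (eq_neg_of_add_eq_zero_left ha).symm
    · exact hevs i
  have hevΦ : ev (aeval z Φ) = eval (fun o => o.elim a₀ a) Φ := by
    have : (ev.comp (aeval z : MvPolynomial (Option σ) k →ₐ[k] _).toRingHom) =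
        eval (fun o => o.elim a₀ a) := by
      refine MvPolynomial.ringHom_ext (fun x => ?_) fun o => ?_
      · simp [ev, MvPolynomial.algebraMap_apply]
      · simp [hevz]
    exact congrArg (fun g : MvPolynomial (Option σ) k →+* k => g Φ) this
  have hrel : ∀ i m, ReductionRelation P c u r (π s) i m (fun j m' => π (μ i m j m')) :=
    fun i m => by
      have := (hμ i m).map π
      rwa [hπξ, Ideal.map_map, show (MvPolynomial.map (π : D →+* k)).comp
        (MvPolynomial.map (algebraMap k D)) = RingHom.id (MvPolynomial σ k) from
          MvPolynomial.ringHom_ext (fun x => by simp) fun i => by simp, Ideal.map_id] at this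
  obtain ⟨j, hj⟩ : ∃ j, ev (replaceDet s μ j) ≠ 0 := by
    by_contra! h
    have h1 : Ideal.span (Set.range (replaceDet s μ)) ≤ RingHom.ker ev := by
      rw [Ideal.span_le]
      rintro _ ⟨j, rfl⟩
      exact h j
    have h2 : ev (C t * aeval z Φ) = 0 := h1 hmem
    rw [map_mul, hevΦ] at h2
    refine (mul_ne_zero ?_ hne) h2
    simpa [ev] using right_ne_zero_of_mul hcf
  rw [eval₂Hom_replaceDet] at hj
  cases d with
  | zero => exact j.elim0
  | succ d' => exact isReductionMember_of_det_ne_zero u (left_ne_zero_of_mul hcf) hrel a j hj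

theorem genericallyReductionMember [Infinite k] {y : Fin d → MvPolynomial σ k}
    (hy : (aeval (fun i => Ideal.Quotient.mk P (y i)) :
      MvPolynomial (Fin d) k →ₐ[k] MvPolynomial σ k ⧸ P).toRingHom.IsIntegral)
    (hcard : d ≤ Fintype.card σ) :
    GenericallyReductionMember P d fun c => ∀ g ∈ P, eval c g = 0 := by
  -- Noetherian induction over ideals containing `P`. For prime `I` an open stratum is handled by
  -- its generic point and the rest by a larger ideal; for `f * g ∈ I` the zero set splits into two
  -- smaller ones.
  have H : ∀ I : Ideal (MvPolynomial σ k), P ≤ I →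
      GenericallyReductionMember P d fun c => ∀ g ∈ I, eval c g = 0 := by
    intro I
    induction I using WellFoundedGT.induction with
    | ind I ih =>
    intro hPI
    have hsup : ∀ f ∉ I, GenericallyReductionMember P d
        fun c => ∀ g ∈ I ⊔ Ideal.span {f}, eval c g = 0 := fun f hf =>
      ih _ (lt_of_le_of_ne le_sup_left fun h => hf (h ▸ Ideal.mem_sup_right
        (Ideal.mem_span_singleton_self f))) (hPI.trans le_sup_left)
    have hmem : ∀ (f : MvPolynomial σ k) (c : σ → k), (∀ g ∈ I, eval c g = 0) → eval c f = 0 →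
        ∀ g ∈ I ⊔ Ideal.span {f}, eval c g = 0 := fun f c hc hf => by
      change I ⊔ Ideal.span {f} ≤ RingHom.ker (eval c)
      exact sup_le hc ((Ideal.span_singleton_le_iff_mem _).2 hf)
    by_cases hI : I.IsPrime
    · obtain ⟨f, hf, h⟩ := exists_generic_stratum hy hcard hPI
      refine h.or (hsup f hf) fun c hc => ?_
      by_cases hcf : eval c f = 0
      · exact Or.inr (hmem f c hc hcf)
      · exact Or.inl ⟨hc, hcf⟩
    · rw [Ideal.isPrime_iff] at hI
      push Not at hI
      by_cases htop : I = ⊤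
      · exact ⟨1, one_ne_zero, fun c hc => by
          have := hc 1 (htop ▸ Submodule.mem_top)
          simp at this⟩
      · obtain ⟨f, g, hfg, hf, hg⟩ := hI htop
        refine (hsup f hf).or (hsup g hg) fun c hc => ?_
        have := hc _ hfg
        rw [map_mul, mul_eq_zero] at this
        exact this.imp (hmem f c hc) (hmem g c hc)
  exact H P le_rfl

end Affine

/-! ### Dimension of affine domains at closed points -/

section Dimension

theorem height_eq_of_isMaximal_mvPolynomial {k : Type*} [Field k] (d : ℕ) :
    ∀ (m : Ideal (MvPolynomial (Fin d) k)) [m.IsMaximal], m.height = d := by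
  induction d with
  | zero =>
    intro m hm
    have e := MvPolynomial.isEmptyRingEquiv k (Fin 0)
    have : IsField (MvPolynomial (Fin 0) k) := e.toMulEquiv.isField (Field.toIsField k)
    let _ := this.toField
    rw [Ideal.eq_bot_of_prime m, Ideal.height_bot, Nat.cast_zero]
  | succ d ih =>
    intro m hm
    let e := (MvPolynomial.finSuccEquiv k d).toRingEquiv.symm
    rw [← RingEquiv.height_comap e m]
    have : (m.comap e).IsMaximal := Ideal.comap_isMaximal_of_equiv e
    have h2 : ((m.comap e).comap (Polynomial.C)).IsMaximal :=
      Polynomial.isMaximal_comap_C_of_isJacobsonRing _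
    have : (m.comap e).LiesOver ((m.comap e).comap (Polynomial.C)) := ⟨rfl⟩
    rw [Polynomial.height_eq_height_add_one ((m.comap e).comap (Polynomial.C)) (m.comap e),
      ih, Nat.cast_succ]

/-- Going down over the polynomial ring reduces the height of `m` to that of its contraction plus
the height in the fibre, and the fibre of an integral extension is zero-dimensional. Thus the local
dimension is `d` at every closed point. -/
theorem height_eq_of_isIntegral {k R : Type*} [Field k] [CommRing R] [IsDomain R]
    [IsNoetherianRing R] [Algebra k R] {d : ℕ} (g : MvPolynomial (Fin d) k →ₐ[k] R)
    (hinj : Function.Injective g) (hint : g.IsIntegral) (m : Ideal R) [hm : m.IsMaximal] :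
    m.height = d := by
  let _ := g.toRingHom.toAlgebra
  have : Algebra.IsIntegral (MvPolynomial (Fin d) k) R := ⟨hint⟩
  have : FaithfulSMul (MvPolynomial (Fin d) k) R :=
    (faithfulSMul_iff_algebraMap_injective _ _).2 hinj
  have hp : (m.under (MvPolynomial (Fin d) k)).IsMaximal :=
    Ideal.isMaximal_comap_of_isIntegral_of_isMaximal m
  set p := m.under (MvPolynomial (Fin d) k) with hpdef
  have : m.LiesOver p := ⟨rfl⟩
  rw [Ideal.height_eq_height_add_of_liesOver_of_hasGoingDown p m,
    height_eq_of_isMaximal_mvPolynomial d p]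
  have h0 : (m.map (Ideal.Quotient.mk (p.map (algebraMap _ R)))).height = 0 := by
    have hdim : Ring.KrullDimLE 0 (R ⧸ p.map (algebraMap _ R)) := .mk₀ fun q hq => by
      set Q := q.comap (Ideal.Quotient.mk (p.map (algebraMap _ R))) with hQ
      have hpQ : p ≤ Q.under (MvPolynomial (Fin d) k) := by
        rw [Ideal.under_def, ← Ideal.map_le_iff_le_comap, hQ, ← Ideal.map_le_iff_le_comap,
          Ideal.map_quotient_self]
        exact bot_le
      have hQp : (Q.under (MvPolynomial (Fin d) k)).IsMaximal :=
        hp.eq_of_le Ideal.IsPrime.ne_top' hpQ ▸ hp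
      have : Q.IsMaximal := Ideal.isMaximal_of_isIntegral_of_isMaximal_comap Q hQp
      have h := Ideal.map_eq_top_or_isMaximal_of_surjective
        (Ideal.Quotient.mk (p.map (algebraMap _ R))) Ideal.Quotient.mk_surjective this
      rw [hQ, Ideal.map_comap_of_surjective _ Ideal.Quotient.mk_surjective] at h
      exact h.resolve_left hq.ne_top
    have hle : p.map (algebraMap _ R) ≤ m := Ideal.map_le_iff_le_comap.2 le_rfl
    have hne : m.map (Ideal.Quotient.mk (p.map (algebraMap _ R))) ≠ ⊤ := by
      intro h
      rw [Ideal.eq_top_iff_one, ← map_one (Ideal.Quotient.mk _),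
        Ideal.mem_quotient_iff_mem hle] at h
      exact hm.ne_top ((Ideal.eq_top_iff_one m).2 h)
    have h1 := (Ideal.height_le_ringKrullDim_of_ne_top hne).trans (Ring.krullDimLE_iff.1 hdim)
    exact le_antisymm (by exact_mod_cast h1) bot_le
  rw [h0, add_zero]

end Dimension

/-! ### Multiplicities of affine hyperplane sections -/

section Local

open ProjVar IsLocalRing

/-- The length of `A ⧸ I` is the coheight of `I` in the lattice of ideals, so it is visibly
invariant under ring isomorphisms. -/
theorem length_quotient_map_ringEquiv {A B : Type*} [CommRing A] [CommRing B] (e : A ≃+* B)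
    (I : Ideal A) :
    Module.length B (B ⧸ I.map (e : A →+* B)) = Module.length A (A ⧸ I) := by
  rw [Module.length_quotient, Module.length_quotient, ← Order.coheight_orderIso
    e.symm.idealComapOrderIso I]
  congr 1
  exact Ideal.map_comap_of_equiv e

theorem ProjVar.HasSamuelMultiplicity.of_ringEquiv {A B : Type*} [CommRing A] [CommRing B]
    (f : A ≃+* B) {q : Ideal A} {q' : Ideal B} (hq : q.map (f : A →+* B) = q') {e : ℕ}
    (h : HasSamuelMultiplicity A q e) : HasSamuelMultiplicity B q' e := by
  subst hq
  obtain ⟨d, hd, hfin, hlim⟩ := h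
  have hlen : ∀ t, Module.length B (B ⧸ q.map (f : A →+* B) ^ t) = Module.length A (A ⧸ q ^ t) :=
    fun t => by rw [← Ideal.map_pow, length_quotient_map_ringEquiv]
  refine ⟨d, by rw [← hd, ringKrullDim_eq_of_ringEquiv f], fun t => ?_, ?_⟩
  · rw [hlen]
    exact hfin t
  · simp_rw [hlen]
    exact hlim

/-- Nakayama: this removes the error by higher powers carried along in the definition of
`IsReductionMember`. -/
theorem pow_succ_le_of_le_sup {A : Type*} [CommRing A] [IsLocalRing A] [IsNoetherianRing A]
    {J : Ideal A} {r : ℕ}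
    (h : maximalIdeal A ^ (r + 1) ≤ J * maximalIdeal A ^ r ⊔ maximalIdeal A ^ (r + 2)) :
    maximalIdeal A ^ (r + 1) ≤ J * maximalIdeal A ^ r := by
  refine Submodule.le_of_le_smul_of_le_jacobson_bot (IsNoetherian.noetherian _)
    (maximalIdeal_le_jacobson _) (h.trans_eq ?_)
  rw [smul_eq_mul, ← pow_succ']

theorem shiftIdeal_eq_ker {k σ : Type*} [Field k] (c : σ → k) :
    shiftIdeal c = RingHom.ker (MvPolynomial.eval c) := by
  refine le_antisymm (Ideal.span_le.2 ?_) fun f hf => ?_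
  · rintro _ ⟨i, rfl⟩
    simp [RingHom.mem_ker]
  · have := sub_C_eval_mem_shiftIdeal c f
    rwa [RingHom.mem_ker.1 hf, map_zero, sub_zero] at this

theorem mem_shiftIdeal_iff {k σ : Type*} [Field k] {c : σ → k} {f : MvPolynomial σ k} :
    f ∈ shiftIdeal c ↔ MvPolynomial.eval c f = 0 := by
  rw [shiftIdeal_eq_ker, RingHom.mem_ker]

instance isMaximal_shiftIdeal {k σ : Type*} [Field k] (c : σ → k) : (shiftIdeal c).IsMaximal := by
  rw [shiftIdeal_eq_ker]
  exact RingHom.ker_isMaximal_of_surjective _ fun a => ⟨MvPolynomial.C a, by simp⟩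

theorem exists_hasSamuelMultiplicity_of_isReductionMember {k σ : Type*} [Field k] [Fintype σ]
    {P : Ideal (MvPolynomial σ k)} [P.IsPrime] {d : ℕ}
    (g : MvPolynomial (Fin d) k →ₐ[k] MvPolynomial σ k ⧸ P) (hinj : Function.Injective g)
    (hint : g.IsIntegral) {c : σ → k} (hPc : P ≤ shiftIdeal c)
    {l : MvPolynomial σ k} (hl : l ∈ shiftIdeal c) (h : IsReductionMember P c l d)
    (S : Type*) [CommRing S] [IsLocalRing S] [Algebra (MvPolynomial σ k) S]
    [IsLocalization.AtPrime S (shiftIdeal c)] :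
    ∃ e, HasSamuelMultiplicity (S ⧸ P.map (algebraMap (MvPolynomial σ k) S))
        ((maximalIdeal S).map (Ideal.Quotient.mk _)) e ∧
      HasSamuelMultiplicity (S ⧸ (P ⊔ Ideal.span {l}).map (algebraMap (MvPolynomial σ k) S))
        ((maximalIdeal S).map (Ideal.Quotient.mk _)) e := by
  obtain ⟨d', rfl, T, r, hT, hred⟩ := h
  have hc := isMaximal_shiftIdeal c
  set I := P.map (algebraMap (MvPolynomial σ k) S) with hI
  have hIp : I.IsPrime := Ideal.isPrime_map_of_isLocalizationAtPrime (shiftIdeal c) hPc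
  have hS : IsNoetherianRing S := IsLocalization.isNoetherianRing (shiftIdeal c).primeCompl S
    inferInstance
  have hA : IsLocalRing (S ⧸ I) := .of_surjective' _ Ideal.Quotient.mk_surjective
  have hmA := map_maximalIdeal_of_surjective (Ideal.Quotient.mk I) Ideal.Quotient.mk_surjective
  have hmS : (shiftIdeal c).map (algebraMap (MvPolynomial σ k) S) = maximalIdeal S :=
    IsLocalization.AtPrime.map_eq_maximalIdeal (shiftIdeal c) S
  let θ : MvPolynomial σ k →+* S ⧸ I := (Ideal.Quotient.mk I).comp (algebraMap _ S)
  have hθm : (shiftIdeal c).map θ = maximalIdeal (S ⧸ I) := by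
    rw [← hmA, ← hmS, Ideal.map_map]
  have hθP : P.map θ = ⊥ := by
    rw [← Ideal.map_map, ← hI, Ideal.map_quotient_self]
  have hdim : ringKrullDim (S ⧸ I) = (d' + 1 : ℕ) := by
    set M := (shiftIdeal c).map (Ideal.Quotient.mk P) with hM
    have hMmax : M.IsMaximal := by
      refine (Ideal.map_eq_top_or_isMaximal_of_surjective _ Ideal.Quotient.mk_surjective
        hc).resolve_left fun h => ?_
      rw [Ideal.eq_top_iff_one, ← map_one (Ideal.Quotient.mk P),
        Ideal.mem_quotient_iff_mem hPc] at h
      exact hc.ne_top ((Ideal.eq_top_iff_one _).2 h)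
    have hsub : Algebra.algebraMapSubmonoid (MvPolynomial σ k ⧸ P) (shiftIdeal c).primeCompl =
        M.primeCompl := by
      ext x
      constructor
      · rintro ⟨y, hy, rfl⟩
        exact fun h => hy ((Ideal.mem_quotient_iff_mem hPc).1 h)
      · obtain ⟨y, rfl⟩ := Ideal.Quotient.mk_surjective x
        exact fun h => ⟨y, fun hy => h (Ideal.mem_map_of_mem _ hy), rfl⟩
    have hloc : IsLocalization.AtPrime (S ⧸ I) M := by
      have : IsLocalization (Algebra.algebraMapSubmonoid (MvPolynomial σ k ⧸ P)
        (shiftIdeal c).primeCompl) (S ⧸ I) := inferInstance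
      rwa [hsub] at this
    rw [IsLocalization.AtPrime.ringKrullDim_eq_height M (S ⧸ I), height_eq_of_isIntegral g hinj hint]
    rfl
  have hred' := Ideal.map_mono (f := θ) hred
  simp only [Ideal.map_sup, Ideal.map_mul, Ideal.map_pow, hθm, hθP, sup_bot_eq, Ideal.map_span,
    Set.image_singleton, ← Set.range_comp] at hred'
  have hθmem : ∀ x ∈ shiftIdeal c, θ x ∈ maximalIdeal (S ⧸ I) := fun x hx =>
    hθm ▸ Ideal.mem_map_of_mem θ hx
  obtain ⟨e, he, he'⟩ := exists_hasSamuelMultiplicity_quotient hdim (hθmem l hl) (θ ∘ T)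
    (fun i => hθmem _ (hT i)) (pow_succ_le_of_le_sup hred')
  refine ⟨e, hmA ▸ he, ?_⟩
  have e1 : Ideal.span {θ l} = (Ideal.span {algebraMap (MvPolynomial σ k) S l}).map
      (Ideal.Quotient.mk I) := by
    rw [Ideal.map_span, Set.image_singleton]; rfl
  have e2 : I ⊔ Ideal.span {algebraMap (MvPolynomial σ k) S l} =
      (P ⊔ Ideal.span {l}).map (algebraMap (MvPolynomial σ k) S) := by
    rw [Ideal.map_sup, Ideal.map_span, Set.image_singleton]
  refine he'.of_ringEquiv (((Ideal.quotEquivOfEq e1).trans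
    (DoubleQuot.quotQuotEquivQuotSup _ _)).trans (Ideal.quotEquivOfEq e2)) ?_
  rw [← hmA, Ideal.map_map, Ideal.map_map]
  rfl

end Local

/-! ### Affine charts of projective space -/

namespace ProjVar

section Chart

open MvPolynomial

variable {k : Type*} [Field k] {n : ℕ}

/-- Dehomogenization with respect to the variable `xᵢ`. -/
noncomputable def dehom (k : Type*) [Field k] {n : ℕ} (i : Fin (n + 1)) :
    CoordRing k n →ₐ[k] MvPolynomial (Fin n) k :=
  aeval (i.insertNth (α := fun _ => MvPolynomial (Fin n) k) 1 X)

@[simp] theorem dehom_X_self (i : Fin (n + 1)) : dehom k i (X i) = 1 := by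
  simp [dehom]

@[simp] theorem dehom_X_succAbove (i : Fin (n + 1)) (j : Fin n) :
    dehom k i (X (i.succAbove j)) = X j := by
  simp [dehom]

theorem exists_isHomogeneous_dehom_eq (i : Fin (n + 1)) (f : MvPolynomial (Fin n) k) :
    ∃ (N : ℕ) (F : CoordRing k n), F.IsHomogeneous N ∧ dehom k i F = f := by
  induction f using MvPolynomial.induction_on with
  | C a => exact ⟨0, C a, isHomogeneous_C _ a, by simp [dehom]⟩
  | add f g hf hg =>
    obtain ⟨N, F, hF, rfl⟩ := hf
    obtain ⟨M, G, hG, rfl⟩ := hg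
    refine ⟨N + M, X i ^ M * F + X i ^ N * G, ?_, by simp⟩
    have h1 := hF.mul ((isHomogeneous_X k i).pow M)
    have h2 := ((isHomogeneous_X k i).pow N).mul hG
    rw [one_mul, mul_comm] at h1
    rw [one_mul] at h2
    exact h1.add h2
  | mul_X f j hf =>
    obtain ⟨N, F, hF, rfl⟩ := hf
    exact ⟨N + 1, F * X (i.succAbove j), hF.mul (isHomogeneous_X k _), by simp⟩

theorem eval₂_mul_of_isHomogeneous {R B σ : Type*} [CommSemiring R] [CommSemiring B] (f : R →+* B)
    (s : B) (b : σ → B) {F : MvPolynomial σ R} {N : ℕ} (hF : F.IsHomogeneous N) :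
    eval₂ f (fun a => s * b a) F = s ^ N * eval₂ f b F := by
  rw [eval₂_eq, eval₂_eq, Finset.mul_sum]
  refine Finset.sum_congr rfl fun α hα => ?_
  have hdeg : ∑ i ∈ α.support, α i = N := by
    rw [← hF (mem_support_iff.1 hα)]
    simp [Finsupp.weight_apply, Finsupp.sum]
  simp only [mul_pow, Finset.prod_mul_distrib, Finset.prod_pow_eq_pow_sum, hdeg]
  ring

/-- The common form of `F(x) = xᵢ ^ N * f(x / xᵢ)`, used for evaluation at a point, for the function
field of the cone and for the local rings. -/
theorem apply_eq_pow_mul_dehom {B : Type*} [CommRing B] {i : Fin (n + 1)} {g : CoordRing k n →+* B}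
    {φ : MvPolynomial (Fin n) k →+* B} (hC : ∀ a, g (C a) = φ (C a))
    (hX : ∀ j, g (X (i.succAbove j)) = g (X i) * φ (X j)) {F : CoordRing k n} {N : ℕ}
    (hF : F.IsHomogeneous N) : g F = g (X i) ^ N * φ (dehom k i F) := by
  have h1 : g = eval₂Hom (φ.comp C) (fun a => g (X i) * φ (dehom k i (X a))) := by
    refine MvPolynomial.ringHom_ext (fun a => by simp [hC]) fun a => ?_
    rcases Fin.eq_self_or_eq_succAbove i a with rfl | ⟨j, rfl⟩
    · simp
    · simp [hX]
  have h2 : φ.comp (dehom k i : CoordRing k n →+* MvPolynomial (Fin n) k) =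
      eval₂Hom (φ.comp C) (fun a => φ (dehom k i (X a))) :=
    MvPolynomial.ringHom_ext (fun a => by simp [dehom]) fun a => by simp
  have h3 := RingHom.congr_fun h2 F
  simp only [RingHom.comp_apply, RingHom.coe_coe, coe_eval₂Hom] at h3
  rw [h3, ← eval₂_mul_of_isHomogeneous (φ.comp C) _ _ hF]
  exact RingHom.congr_fun h1 F

theorem homogeneousComponent_mem {I : Ideal (CoordRing k n)} (hI : I.IsHomogeneous (grading k n))
    {F : CoordRing k n} (hF : F ∈ I) (N : ℕ) : homogeneousComponent N F ∈ I := by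
  have := hI N hF
  rwa [← MvPolynomial.decomposition.decompose'_apply]

/-- The dehomogenized ideal is the kernel of `xⱼ ↦ xⱼ / xᵢ` into the fraction field of the
homogeneous coordinate ring of `V₊(P)`. -/
theorem isPrime_map_dehom {P : Ideal (CoordRing k n)} (hhom : P.IsHomogeneous (grading k n))
    (hP : P.IsPrime) {i : Fin (n + 1)} (hi : X i ∉ P) : (P.map (dehom k i)).IsPrime := by
  let L := FractionRing (CoordRing k n ⧸ P)
  let g : CoordRing k n →+* L := (algebraMap (CoordRing k n ⧸ P) L).comp (Ideal.Quotient.mk P)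
  have hg : ∀ F, g F = 0 ↔ F ∈ P := fun F => by
    rw [RingHom.comp_apply, FaithfulSMul.algebraMap_eq_zero_iff, Ideal.Quotient.eq_zero_iff_mem]
  have hgi : g (X i) ≠ 0 := fun h => hi ((hg _).1 h)
  let φ : MvPolynomial (Fin n) k →+* L :=
    eval₂Hom (g.comp C) (fun j => g (X (i.succAbove j)) / g (X i))
  have key : ∀ {F : CoordRing k n} {N : ℕ}, F.IsHomogeneous N →
      g F = g (X i) ^ N * φ (dehom k i F) := fun hF =>
    apply_eq_pow_mul_dehom (fun a => by simp [φ]) (fun j => by simp [φ, mul_div_cancel₀ _ hgi]) hF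
  have hker : P.map (dehom k i) = RingHom.ker φ := by
    refine le_antisymm (Ideal.map_le_iff_le_comap.2 fun F hF => ?_) fun f hf => ?_
    · rw [Ideal.mem_comap, RingHom.mem_ker, ← sum_homogeneousComponent F, map_sum, map_sum]
      refine Finset.sum_eq_zero fun N _ => ?_
      have h1 := key (homogeneousComponent_isHomogeneous N F)
      rw [(hg _).2 (homogeneousComponent_mem hhom hF N)] at h1
      exact (mul_eq_zero.1 h1.symm).resolve_left (pow_ne_zero _ hgi)
    · obtain ⟨N, F, hF, rfl⟩ := exists_isHomogeneous_dehom_eq i f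
      refine Ideal.mem_map_of_mem _ ((hg F).1 ?_)
      rw [key hF, RingHom.mem_ker.1 hf, mul_zero]
  rw [hker]
  exact RingHom.ker_isPrime φ

end Chart

end ProjVar

/-! ### Local rings of projective schemes in a chart -/

namespace ProjVar

section LocalChart

open MvPolynomial

variable {k : Type*} [Field k] {n : ℕ} {p : PPoint k n} {i : Fin (n + 1)}

theorem mem_pointIdeal_iff {F : CoordRing k n} {N : ℕ} (hF : F.IsHomogeneous N) :
    F ∈ pointIdeal p ↔ eval p.rep F = 0 := by
  have h : (aeval (fun i => Polynomial.C (p.rep i) * Polynomial.X) :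
      CoordRing k n →ₐ[k] Polynomial k) F = Polynomial.X ^ N * Polynomial.C (eval p.rep F) := by
    have h1 : Polynomial.C.comp (eval p.rep) = eval₂Hom (algebraMap k (Polynomial k))
        (fun i => Polynomial.C (p.rep i)) :=
      MvPolynomial.ringHom_ext (fun a => by simp) fun i => by simp
    have h2 := RingHom.congr_fun h1 F
    rw [RingHom.comp_apply, coe_eval₂Hom] at h2
    rw [h2, ← eval₂_mul_of_isHomogeneous _ _ _ hF, aeval_def]
    simp only [mul_comm]
  rw [pointIdeal, RingHom.mem_ker]
  erw [h]
  simp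

/-- The affine coordinates of a point in the chart where the variable `xᵢ` does not vanish. -/
noncomputable def chartPoint (p : PPoint k n) (i : Fin (n + 1)) : Fin n → k :=
  fun j => p.rep (i.succAbove j) / p.rep i

theorem X_mem_pointIdeal_iff : (X i : CoordRing k n) ∈ pointIdeal p ↔ p.rep i = 0 := by
  rw [mem_pointIdeal_iff (isHomogeneous_X k i), eval_X]

theorem eval_rep_eq (hi : p.rep i ≠ 0) {F : CoordRing k n} {N : ℕ} (hF : F.IsHomogeneous N) :
    eval p.rep F = p.rep i ^ N * eval (chartPoint p i) (dehom k i F) := by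
  rw [apply_eq_pow_mul_dehom (i := i) (g := eval p.rep) (φ := eval (chartPoint p i))
    (fun a => by simp) (fun j => by simp [chartPoint, mul_div_cancel₀ _ hi]) hF, eval_X]

theorem mem_pointIdeal_iff_dehom (hi : p.rep i ≠ 0) {F : CoordRing k n} {N : ℕ}
    (hF : F.IsHomogeneous N) : F ∈ pointIdeal p ↔ dehom k i F ∈ shiftIdeal (chartPoint p i) := by
  rw [mem_pointIdeal_iff hF, mem_shiftIdeal_iff, eval_rep_eq hi hF, mul_eq_zero,
    or_iff_right (pow_ne_zero _ hi)]

/-- The coordinate ring of an affine chart maps to the local rings at the points of this chart. -/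
noncomputable def chartHom (hi : p.rep i ≠ 0) : MvPolynomial (Fin n) k →+* PLocalRing p :=
  eval₂Hom ((algebraMap (grading k n 0) (PLocalRing p)).comp (algebraMap k (grading k n 0)))
    fun j => HomogeneousLocalization.mk ⟨1, ⟨X (i.succAbove j), isHomogeneous_X k _⟩,
      ⟨X i, isHomogeneous_X k i⟩, fun h => hi (X_mem_pointIdeal_iff.1 h)⟩

/-- The map from the coordinate ring of an affine chart to the localization of the homogeneous
coordinate ring at a point. -/
noncomputable def chartHomVal (hi : p.rep i ≠ 0) :
    MvPolynomial (Fin n) k →+* Localization.AtPrime (pointIdeal p) :=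
  (algebraMap (PLocalRing p) (Localization.AtPrime (pointIdeal p))).comp (chartHom hi)

theorem algebraMap_eq_pow_mul (hi : p.rep i ≠ 0) {F : CoordRing k n} {N : ℕ}
    (hF : F.IsHomogeneous N) : algebraMap (CoordRing k n) (Localization.AtPrime (pointIdeal p)) F =
      algebraMap (CoordRing k n) (Localization.AtPrime (pointIdeal p)) (X i) ^ N *
        chartHomVal hi (dehom k i F) := by
  refine apply_eq_pow_mul_dehom (fun a => ?_) (fun j => ?_) hF
  · rw [chartHomVal, chartHom, RingHom.comp_apply, eval₂Hom_C, RingHom.comp_apply,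
      ← IsScalarTower.algebraMap_apply]
    rfl
  · rw [chartHomVal, chartHom, RingHom.comp_apply, eval₂Hom_X',
      HomogeneousLocalization.algebraMap_apply, HomogeneousLocalization.val_mk,
      Localization.mk_eq_mk']
    exact (IsLocalization.mk'_spec' _ (X (i.succAbove j) : CoordRing k n)
      (⟨X i, fun h => hi (X_mem_pointIdeal_iff.1 h)⟩ : (pointIdeal p).primeCompl)).symm

theorem isUnit_algebraMap_X (hi : p.rep i ≠ 0) :
    IsUnit (algebraMap (CoordRing k n) (Localization.AtPrime (pointIdeal p)) (X i)) :=
  IsLocalization.map_units _ (⟨X i, fun h => hi (X_mem_pointIdeal_iff.1 h)⟩ :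
    (pointIdeal p).primeCompl)

theorem isUnit_chartHom (hi : p.rep i ≠ 0) {f : MvPolynomial (Fin n) k}
    (hf : f ∉ shiftIdeal (chartPoint p i)) : IsUnit (chartHom hi f) := by
  obtain ⟨N, F, hF, rfl⟩ := exists_isHomogeneous_dehom_eq i f
  rw [← mem_pointIdeal_iff_dehom hi hF] at hf
  have h := IsLocalization.map_units (Localization.AtPrime (pointIdeal p))
    (⟨F, hf⟩ : (pointIdeal p).primeCompl)
  rw [algebraMap_eq_pow_mul hi hF] at h
  exact (HomogeneousLocalization.isUnit_iff_isUnit_val _ _ _).1 (isUnit_of_mul_isUnit_right h)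

theorem mk_mul_chartHom (hi : p.rep i ≠ 0)
    (z : HomogeneousLocalization.NumDenSameDeg (grading k n) (pointIdeal p).primeCompl) :
    HomogeneousLocalization.mk z * chartHom hi (dehom k i z.den) =
      chartHom hi (dehom k i z.num) := by
  refine HomogeneousLocalization.val_injective _
    (((isUnit_algebraMap_X hi).pow z.deg).mul_left_cancel ?_)
  have h1 := algebraMap_eq_pow_mul hi z.num.2
  have h2 := algebraMap_eq_pow_mul hi z.den.2
  rw [HomogeneousLocalization.val_mul, mul_left_comm, HomogeneousLocalization.val_mk]
  change _ * (_ * chartHomVal hi _) = _ * chartHomVal hi _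
  rw [← h1, ← h2, Localization.mk_eq_mk', IsLocalization.mk'_spec]

theorem chartHom_injective (hi : p.rep i ≠ 0) : Function.Injective (chartHom (p := p) hi) := by
  rw [injective_iff_map_eq_zero]
  intro f hf
  obtain ⟨N, F, hF, rfl⟩ := exists_isHomogeneous_dehom_eq i f
  have h := algebraMap_eq_pow_mul hi hF
  rw [chartHomVal, RingHom.comp_apply, hf, map_zero, mul_zero] at h
  rw [(FaithfulSMul.algebraMap_eq_zero_iff _ _).1 h, map_zero]

theorem isLocalization_chartHom (hi : p.rep i ≠ 0) :
    letI := (chartHom hi).toAlgebra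
    IsLocalization.AtPrime (PLocalRing p) (shiftIdeal (chartPoint p i)) := by
  let _ := (chartHom hi).toAlgebra
  refine ⟨fun f => isUnit_chartHom hi f.2, fun z => ?_, fun {f g} hfg => ⟨1, ?_⟩⟩
  · obtain ⟨z, rfl⟩ := HomogeneousLocalization.mk_surjective z
    exact ⟨(dehom k i z.num, ⟨dehom k i z.den,
      fun h => z.den_mem ((mem_pointIdeal_iff_dehom hi z.den.2).2 h)⟩), mk_mul_chartHom hi z⟩
  · rw [chartHom_injective hi hfg]

theorem stalkIdeal_eq_map_chartHom (hi : p.rep i ≠ 0) {I : Ideal (CoordRing k n)}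
    (hI : I.IsHomogeneous (grading k n)) :
    stalkIdeal I p = (I.map (dehom k i)).map (chartHom hi) := by
  apply le_antisymm
  · intro z hz
    obtain ⟨z, rfl⟩ := HomogeneousLocalization.mk_surjective z
    have h1 : algebraMap _ (Localization.AtPrime (pointIdeal p)) (z.num : CoordRing k n) ∈
        I.map (algebraMap (CoordRing k n) (Localization.AtPrime (pointIdeal p))) := by
      have := Ideal.mul_mem_right (algebraMap _ (Localization.AtPrime (pointIdeal p))
        (z.den : CoordRing k n)) _ (Ideal.mem_comap.1 hz)
      rwa [HomogeneousLocalization.algebraMap_apply, HomogeneousLocalization.val_mk,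
        Localization.mk_eq_mk', IsLocalization.mk'_spec] at this
    rw [IsLocalization.algebraMap_mem_map_algebraMap_iff (pointIdeal p).primeCompl] at h1
    obtain ⟨w, hw, hwz⟩ := h1
    -- A homogeneous denominator is needed to dehomogenize: some component of `w` avoids the prime
    -- of `p`, and it still multiplies the numerator into the homogeneous ideal `I`.
    obtain ⟨e, he⟩ : ∃ e, homogeneousComponent e w ∉ pointIdeal p := by
      by_contra! h
      refine hw ?_
      rw [← sum_homogeneousComponent w]
      exact sum_mem fun e _ => h e
    have hwe := homogeneousComponent_isHomogeneous e w
    have h2 : homogeneousComponent e w * z.num ∈ I := by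
      have := hI (e + z.deg) hwz
      rw [DirectSum.coe_decompose_mul_add_of_right_mem (grading k n) z.num.2] at this
      rwa [← MvPolynomial.decomposition.decompose'_apply]
    have h3 : dehom k i (homogeneousComponent e w) * dehom k i z.den ∉
        shiftIdeal (chartPoint p i) := by
      rw [(isMaximal_shiftIdeal _).isPrime.mul_mem_iff_mem_or_mem, not_or,
        ← mem_pointIdeal_iff_dehom hi hwe, ← mem_pointIdeal_iff_dehom hi z.den.2]
      exact ⟨he, z.den_mem⟩
    refine (Ideal.unit_mul_mem_iff_mem _ (isUnit_chartHom hi h3)).1 ?_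
    rw [map_mul, mul_assoc, mul_comm (chartHom hi (dehom k i z.den)), mk_mul_chartHom hi z,
      ← map_mul, ← map_mul]
    exact Ideal.mem_map_of_mem _ (Ideal.mem_map_of_mem _ h2)
  · rw [Ideal.map_le_iff_le_comap, Ideal.map_le_iff_le_comap]
    intro F hF
    rw [Ideal.mem_comap, Ideal.mem_comap, ← sum_homogeneousComponent F, map_sum, map_sum]
    refine sum_mem fun N _ => ?_
    have h1 := Ideal.mem_map_of_mem (algebraMap (CoordRing k n)
      (Localization.AtPrime (pointIdeal p))) (homogeneousComponent_mem hI hF N)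
    rw [algebraMap_eq_pow_mul hi (homogeneousComponent_isHomogeneous N F),
      Ideal.unit_mul_mem_iff_mem _ ((isUnit_algebraMap_X hi).pow N)] at h1
    exact h1

end LocalChart

end ProjVar

/-! ### Generic hyperplane sections -/

namespace ProjVar

section Generic

open MvPolynomial

variable {k : Type*} [Field k] {n : ℕ}

theorem map_dehom_le_shiftIdeal {I : Ideal (CoordRing k n)} (hI : I.IsHomogeneous (grading k n))
    {p : PPoint k n} {i : Fin (n + 1)} (hi : p.rep i ≠ 0) (h : MemV I p) :
    I.map (dehom k i) ≤ shiftIdeal (chartPoint p i) := by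
  rw [Ideal.map_le_iff_le_comap]
  intro F hF
  rw [Ideal.mem_comap, ← sum_homogeneousComponent F, map_sum]
  exact sum_mem fun N _ => (mem_pointIdeal_iff_dehom hi (homogeneousComponent_isHomogeneous N F)).1
    (h (homogeneousComponent_mem hI hF N))

/-- The linear form with given coefficients. -/
noncomputable def formOfCoeffs (b : Fin (n + 1) → k) : CoordRing k n := ∑ i, C (b i) * X i

theorem isHomogeneous_formOfCoeffs (b : Fin (n + 1) → k) : (formOfCoeffs b).IsHomogeneous 1 :=
  IsHomogeneous.sum _ _ _ fun i _ => by
    simpa using (isHomogeneous_C _ (b i)).mul (isHomogeneous_X k i)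

theorem dehom_formOfCoeffs (b : Fin (n + 1) → k) (i : Fin (n + 1)) :
    dehom k i (formOfCoeffs b) = C (b i) + ∑ j, C (b (i.succAbove j)) * X j := by
  have hC : ∀ a, dehom k i (C a) = C a := fun a => by simp [dehom]
  simp [formOfCoeffs, Fin.sum_univ_succAbove _ i, hC]

theorem isHomogeneous_sup_formOfCoeffs {P : Ideal (CoordRing k n)}
    (hhom : P.IsHomogeneous (grading k n)) (b : Fin (n + 1) → k) :
    (P ⊔ Ideal.span {formOfCoeffs b}).IsHomogeneous (grading k n) :=
  hhom.sup (Ideal.homogeneous_span _ _ (by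
    rintro _ rfl
    exact ⟨1, isHomogeneous_formOfCoeffs b⟩))

theorem hasMultiplicityAt_of_eq {I : Ideal (CoordRing k n)} {p : PPoint k n}
    {J : Ideal (PLocalRing p)} (hJ : stalkIdeal I p = J) {e : ℕ}
    (h : HasSamuelMultiplicity (PLocalRing p ⧸ J)
      ((IsLocalRing.maximalIdeal (PLocalRing p)).map (Ideal.Quotient.mk J)) e) :
    HasMultiplicityAt I p e := by
  subst hJ
  exact h

theorem exists_generic_chart [Infinite k] {P : Ideal (CoordRing k n)}
    (hhom : P.IsHomogeneous (grading k n)) (hP : P.IsPrime) {i : Fin (n + 1)} (hi : X i ∉ P) :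
    ∃ Φ : CoordRing k n, Φ ≠ 0 ∧ ∀ b, eval b Φ ≠ 0 → ∀ p : PPoint k n, p.rep i ≠ 0 →
      MemV (P ⊔ Ideal.span {formOfCoeffs b}) p → ∃ e, HasMultiplicityAt P p e ∧
        HasMultiplicityAt (P ⊔ Ideal.span {formOfCoeffs b}) p e := by
  have hPi := isPrime_map_dehom hhom hP hi
  obtain ⟨d, hd, g, hinj, hint⟩ := exists_integral_inj_algHom_of_quotient (P.map (dehom k i))
    hPi.ne_top
  choose y hy using fun j => Ideal.Quotient.mk_surjective (g (X j))
  have hg : aeval (fun j => Ideal.Quotient.mk (P.map (dehom k i)) (y j)) = g := by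
    ext j
    simp [hy]
  obtain ⟨Φ, hΦ, H⟩ := genericallyReductionMember (P := P.map (dehom k i)) (y := y)
    (by rw [hg]; exact hint) (by rwa [Fintype.card_fin])
  -- In the chart of `xᵢ` the coefficient of `xᵢ` becomes the constant term, indexed by `none`.
  have hinj' : Function.Injective fun o : Option (Fin n) => o.elim i i.succAbove := by
    rintro (_ | a) (_ | a') h
    · rfl
    · exact absurd h (Fin.ne_succAbove _ _)
    · exact absurd h (Fin.succAbove_ne _ _)
    · exact congrArg some (Fin.succAbove_right_injective h)
  refine ⟨rename _ Φ, (rename_injective _ hinj').ne hΦ |>.trans_eq (map_zero _), ?_⟩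
  intro b hb p hpi hp
  have hb' : eval (fun o : Option (Fin n) => o.elim (b i) fun j => b (i.succAbove j)) Φ ≠ 0 := by
    rw [eval_rename] at hb
    convert hb using 3
    ext o
    cases o <;> rfl
  have hPc := map_dehom_le_shiftIdeal hhom hpi (le_sup_left.trans hp)
  have hl : dehom k i (formOfCoeffs b) ∈ shiftIdeal (chartPoint p i) :=
    (mem_pointIdeal_iff_dehom hpi (isHomogeneous_formOfCoeffs b)).1
      (hp (Ideal.mem_sup_right (Ideal.mem_span_singleton_self _)))
  have h0 : b i + ∑ j, b (i.succAbove j) * chartPoint p i j = 0 := by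
    rw [mem_shiftIdeal_iff, dehom_formOfCoeffs] at hl
    simpa using hl
  have hform : shiftForm (chartPoint p i) (fun j => b (i.succAbove j)) =
      dehom k i (formOfCoeffs b) := by
    rw [dehom_formOfCoeffs, eq_neg_of_add_eq_zero_left h0, shiftForm_apply]
    simp only [smul_sub, smul_eq_C_mul, Finset.sum_sub_distrib, map_neg, map_sum, map_mul]
    ring
  have hmem := H (chartPoint p i) (fun f hf => mem_shiftIdeal_iff.1 (hPc hf)) _ _ h0 hb'
  rw [hform] at hmem
  let _ := (chartHom hpi).toAlgebra
  have := isLocalization_chartHom hpi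
  obtain ⟨e, he, he'⟩ := exists_hasSamuelMultiplicity_of_isReductionMember g hinj hint hPc hl hmem
    (PLocalRing p)
  refine ⟨e, hasMultiplicityAt_of_eq (stalkIdeal_eq_map_chartHom hpi hhom) he,
    hasMultiplicityAt_of_eq ?_ he'⟩
  rw [stalkIdeal_eq_map_chartHom hpi (isHomogeneous_sup_formOfCoeffs hhom b), Ideal.map_sup,
    Ideal.map_span, Set.image_singleton]
  rfl

theorem exists_generic_form [Infinite k] {P : Ideal (CoordRing k n)}
    (hhom : P.IsHomogeneous (grading k n)) (hP : P.IsPrime) :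
    ∃ Φ : CoordRing k n, Φ ≠ 0 ∧ ∀ b, eval b Φ ≠ 0 → ∀ p : PPoint k n,
      MemV (P ⊔ Ideal.span {formOfCoeffs b}) p → ∃ e, HasMultiplicityAt P p e ∧
        HasMultiplicityAt (P ⊔ Ideal.span {formOfCoeffs b}) p e := by
  have h : ∀ i : Fin (n + 1), ∃ Φ : CoordRing k n, Φ ≠ 0 ∧ (X i ∉ P → ∀ b, eval b Φ ≠ 0 →
      ∀ p : PPoint k n, p.rep i ≠ 0 → MemV (P ⊔ Ideal.span {formOfCoeffs b}) p →
        ∃ e, HasMultiplicityAt P p e ∧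
          HasMultiplicityAt (P ⊔ Ideal.span {formOfCoeffs b}) p e) := fun i => by
    by_cases hi : X i ∈ P
    -- If `xᵢ ∈ P`, the variety misses this chart and no condition is imposed.
    · exact ⟨1, one_ne_zero, fun h => absurd hi h⟩
    · obtain ⟨Φ, hΦ, H⟩ := exists_generic_chart hhom hP hi
      exact ⟨Φ, hΦ, fun _ => H⟩
  choose Φ hΦ H using h
  refine ⟨∏ i, Φ i, Finset.prod_ne_zero_iff.2 fun i _ => hΦ i, fun b hb p hp => ?_⟩
  obtain ⟨i, hi⟩ := Function.ne_iff.1 p.rep_nonzero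
  rw [map_prod] at hb
  exact H i (fun h => hi (X_mem_pointIdeal_iff.1 (hp (Ideal.mem_sup_left h)))) b
    (Finset.prod_ne_zero_iff.1 hb i (Finset.mem_univ i)) p hi hp

/-- `Φ` need not be homogeneous, but along the line through `v` it is a polynomial in `t` whose
coefficients are the values of its components. Rescaling the equation does not change the
hyperplane, so one nonzero component suffices. -/
theorem exists_eval_smul_ne_zero [Infinite k] {σ : Type*} {Φ : MvPolynomial σ k} {v : σ → k}
    {N : ℕ} (h : eval v (homogeneousComponent N Φ) ≠ 0) :
    ∃ t : k, t ≠ 0 ∧ eval (t • v) Φ ≠ 0 := by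
  let f : Polynomial k := ∑ i ∈ Finset.range (Φ.totalDegree + 1),
    Polynomial.monomial i (eval v (homogeneousComponent i Φ))
  have hN : N ∈ Finset.range (Φ.totalDegree + 1) := by
    rw [Finset.mem_range]
    by_contra hN
    exact h (by rw [homogeneousComponent_eq_zero _ _ (by omega), map_zero])
  have hf : f ≠ 0 := fun hf => h (by
    have := congrArg (Polynomial.coeff · N) hf
    simp only [f, Polynomial.finsetSum_coeff, Polynomial.coeff_monomial, Polynomial.coeff_zero,
      Finset.sum_ite_eq', if_pos hN] at this
    exact this)
  have heval : ∀ t, f.eval t = eval (t • v) Φ := fun t => by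
    conv_rhs => rw [← sum_homogeneousComponent Φ, map_sum]
    simp only [f, Polynomial.eval_finsetSum, Polynomial.eval_monomial]
    refine Finset.sum_congr rfl fun i _ => ?_
    have := eval₂_mul_of_isHomogeneous (RingHom.id k) t v (homogeneousComponent_isHomogeneous i Φ)
    rw [mul_comm]
    exact this.symm
  obtain ⟨t, ht⟩ : ∃ t, (Polynomial.X * f).eval t ≠ 0 := by
    by_contra! h
    exact mul_ne_zero Polynomial.X_ne_zero hf (Polynomial.funext fun t => by simp [h])
  rw [Polynomial.eval_mul, Polynomial.eval_X, heval] at ht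
  exact ⟨t, left_ne_zero_of_mul ht, right_ne_zero_of_mul ht⟩

theorem span_formOfCoeffs_smul {t : k} (ht : t ≠ 0) (b : Fin (n + 1) → k) :
    Ideal.span {formOfCoeffs (t • b)} = Ideal.span {formOfCoeffs b} := by
  have h : formOfCoeffs (t • b) = C t * formOfCoeffs b := by
    simp [formOfCoeffs, Finset.mul_sum, mul_assoc]
  rw [h]
  exact Ideal.span_singleton_mul_left_unit ((isUnit_iff_ne_zero.2 ht).map C) _

end Generic

end ProjVar

theorem mainTheorem9 {k : Type*} [Field k] [IsAlgClosed k] [CharZero k] (n : ℕ)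
    (P : Ideal (ProjVar.CoordRing k n))
    (hhom : P.IsHomogeneous (ProjVar.grading k n)) (hprime : P.IsPrime)
    (hrel : ¬ (HomogeneousIdeal.irrelevant (ProjVar.grading k n)).toIdeal ≤ P) :
    ∃ U : Set (ProjVar.PPoint k n), ProjVar.IsZariskiOpen U ∧ U.Nonempty ∧
      ∀ a ∈ U, ∀ p : ProjVar.PPoint k n,
        ProjVar.MemV (ProjVar.hyperplaneSection P a) p →
          ∃ e : ℕ, ProjVar.HasMultiplicityAt P p e ∧
            ProjVar.HasMultiplicityAt (ProjVar.hyperplaneSection P a) p e := by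
  classical
  obtain ⟨Φ, hΦ, H⟩ := ProjVar.exists_generic_form hhom hprime
  refine ⟨{a | ∃ N, MvPolynomial.eval a.rep (MvPolynomial.homogeneousComponent N Φ) ≠ 0},
    ⟨Set.range fun N => MvPolynomial.homogeneousComponent N Φ, ?_, fun a => ?_⟩, ?_, ?_⟩
  · rintro _ ⟨N, rfl⟩
    exact ⟨N, MvPolynomial.homogeneousComponent_isHomogeneous N Φ⟩
  · simp
  -- The factor `X 0` guarantees `v ≠ 0`, so that `v` defines a hyperplane.
  · obtain ⟨v, hv⟩ : ∃ v, MvPolynomial.eval v (MvPolynomial.X 0 * Φ) ≠ 0 := by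
      by_contra! h
      exact mul_ne_zero (MvPolynomial.X_ne_zero 0) hΦ (MvPolynomial.funext fun v => by simp [h])
    rw [map_mul, MvPolynomial.eval_X] at hv
    have hv0 : v ≠ 0 := fun h => left_ne_zero_of_mul hv (by rw [h]; rfl)
    refine ⟨Projectivization.mk k v hv0, ?_⟩
    obtain ⟨t, ht⟩ := Projectivization.exists_smul_eq_mk_rep k v hv0
    by_contra! h
    simp only [Set.mem_ofPred_eq, not_exists, not_not] at h
    refine right_ne_zero_of_mul hv ?_
    have hvt : v = (t⁻¹ : kˣ) • (Projectivization.mk k v hv0).rep := by rw [← ht, inv_smul_smul]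
    rw [← MvPolynomial.sum_homogeneousComponent Φ, map_sum]
    refine Finset.sum_eq_zero fun N _ => ?_
    have h1 := ProjVar.eval₂_mul_of_isHomogeneous (RingHom.id k) ((t⁻¹ : kˣ) : k)
      (Projectivization.mk k v hv0).rep (MvPolynomial.homogeneousComponent_isHomogeneous N Φ)
    rw [hvt]
    refine h1.trans ?_
    exact mul_eq_zero_of_right _ (h N)
  · rintro a ⟨N, hN⟩ p hp
    obtain ⟨t, ht, hΦt⟩ := ProjVar.exists_eval_smul_ne_zero hN
    have h1 : P ⊔ Ideal.span {ProjVar.formOfCoeffs (t • a.rep)} = ProjVar.hyperplaneSection P a := by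
      rw [ProjVar.span_formOfCoeffs_smul ht]
      rfl
    have h2 := H _ hΦt p
    rw [h1] at h2
    exact h2 hp
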